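/- **Weak b-bicategories and weak b-functors.** A *weak b-bicategory* is a bicategory $\mathbf C$ with a pseudofunctor $\otimes:\mathbf C\times\mathbf C\to\mathbf C$, pseudo-natural 1-cells $\beta_{X,Y,Z}:X\otimes(Y\otimes Z)\to Y\otimes(X\otimes Z)$ (not required to be equivalences) with pseudo-naturality 2-cells $b_{f,g,h}:\beta\,;(g\otimes(f\otimes h))\cong(f\otimes(g\otimes h))\,;\beta$, and invertible 2-cells, natural in $X,Y,Z,W$ (that is, forming a modification), $$\gamma_{X,Y,Z,W}:\ \beta_{X,Y,ZW}\,;1\beta_{X,Z,W}\,;\beta_{Y,Z,XW}\ \Rightarrow\ 1\beta_{Y,Z,W}\,;\beta_{X,Z,YW}\,;1\beta_{X,Y,W}$$ (here "$;$" is composition in diagrammatic order and $\otimes$ is suppressed), such that the two pastings of the cells $\gamma$, $1\gamma$ and $b_{1,1,\beta}$ along the three-dimensional permutohedron, from $\beta_{X,Y,ZUV};1\beta_{X,Z,UV};11\beta_{X,U,V};\beta_{Y,Z,UXV};1\beta_{Y,U,XV};\beta_{Z,U,YXV}$ to $11\beta_{Z,U,V};1\beta_{Y,U,ZV};11\beta_{Y,Z,V};\beta_{X,U,ZYV};1\beta_{X,Z,YV};11\beta_{X,Y,V}$,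 agree. A *weak b-functor structure* on the identity functor of $\mathbf C$ consists of pseudo-natural 1-cells $F_{X,Y}:X\otimes Y\to X\otimes Y$ (not required to be equivalences) and invertible 2-cells, natural in $X,Y,Z$ (forming a modification), $$\phi_{X,Y,Z}:\ \beta_{X,Y,Z}\,;F_{Y,XZ}\,;1F_{X,Z}\ \Rightarrow\ F_{X,YZ}\,;1F_{Y,Z}\,;\beta_{X,Y,Z},$$ satisfying the coherence condition that the following two pastings (filled up with the pseudo-naturality squares of $F$ and $\beta$), from $\beta_{X,Y,ZW};1\beta_{X,Z,W};\beta_{Y,Z,XW};F_{Z,YXW};1F_{Y,XW};11F_{X,W}$ to $F_{X,YZW};1F_{Y,ZW};11F_{Z,W};1\beta_{Y,Z,W};\beta_{X,Z,YW};1\beta_{X,Y,W}$, agree: the one using $\gamma_{X,Y,Z,W}$, $1\phi_{X,Y,W}$, $\phi_{X,Z,YW}$, $1\phi_{Y,Z,W}$ in this order, and the one using $\phi_{Y,Z,XW}$, $1\phi_{X,Z,W}$, $\phi_{X,Y,ZW}$, $\gamma_{X,Y,Z,W}$ in this order. **Setting.** Let $\mathbf C$ be a weak b-bicategory with a single object $I$,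 and let $\mathcal E=\mathbf C(I,I)$, a monoidal category with $f\otimes g$ the composite of first $f$ and then $g$ (associativity isomorphisms are suppressed). Assume given an identification of the pseudofunctor $I\otimes-$ with the identity, that is, natural isomorphisms $1\otimes f\cong f$ in $\mathcal E$ compatible with composition and identities. Put $B=\beta_{I,I,I}\in\mathcal E$; the cells $b_{1,1,X}$ give a half-braiding $t_{B,X}:B\otimes X\to X\otimes B$. Assume $t_{B,B}^2=1$. Through the identification, $\gamma_{I,I,I,I}$ is an automorphism $S$ of $B^{\otimes 3}$, and $Z\in\mathrm{Aut}(B^{\otimes3})$ is defined by $S=t_1t_2t_1Z$ ($t_i$ being the half-braiding isomorphism exchanging the $i$-th and $(i+1)$-st tensor factors; products of morphisms are applied from right to left). A pseudo-natural transformation $F$ from $\otimes$ to $\otimes$ is an object $C=F_{I,I}\in\mathcal E$ with pseudo-naturality cells; those at $(1,X)$ give a half-braiding $t_{C,X}:C\otimes X\to X\otimes C$. We say "object $C$" for such an object with its pseudo-naturality cells, and call $C$ *admissible* if $t_{B,C}$ and $t_{C,B}$ are inverse to each other and $t_{C,C}^2=1$. Through the identification, the 2-cell $\phi_{I,I,I}$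 is an isomorphism $M:B\otimes C^{\otimes2}\to C^{\otimes2}\otimes B$. **Proposition.** The assignment $(C,\phi)\mapsto(C,L)$, $L=t_1t_2t_1M^{-1}$, is a bijection from the set of weak b-functor structures on $\mathrm{Id}_{\mathbf C}$ with admissible $C$ onto the set of pairs $(C,L)$ consisting of an admissible object $C$ and an automorphism $L$ of $C^{\otimes2}\otimes B$ such that the 2-cell given by $M=L^{-1}t_1t_2t_1$ is natural (a modification, i.e. compatible with the pseudo-naturality cells of $B$ and $C$) and $$L_{124}L_{135}L_{236}Z_{456}=Z_{456}L_{236}L_{135}L_{124}\qquad\text{in }\mathcal E(C^{\otimes3}\otimes B^{\otimes3},C^{\otimes3}\otimes B^{\otimes3}),$$ where $L_{124}=t_3^{-1}L_{123}t_3$, $L_{135}=(t_3t_4t_2)^{-1}L_{123}(t_3t_4t_2)$, $L_{236}=(t_4t_5)^{-1}L_{234}(t_4t_5)$. The same assignment is also a bijection if the naturality condition is dropped on both sides: the coherence condition for $\phi$ alone corresponds to the displayed relation alone. -/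

import Mathlib

open CategoryTheory

namespace BBicat

universe w₁ w₂ w₃ w₄ v₁ v₂ v₃ v₄ u₁ u₂ u₃ u₄ v u

/-! ### Auxiliary pseudofunctors between products of bicategories -/

section Products

open scoped CategoryTheory.Bicategory CategoryTheory.Prod

variable {𝒜 : Type u₁} [Bicategory.{w₁, v₁} 𝒜] {ℬ : Type u₂} [Bicategory.{w₂, v₂} ℬ]
  {𝒞 : Type u₃} [Bicategory.{w₃, v₃} 𝒞] {𝒟 : Type u₄} [Bicategory.{w₄, v₄} 𝒟]

/-- The product `P × Q` of two pseudofunctors. -/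
def prodMap (P : 𝒜 ⥤ᵖ 𝒞) (Q : ℬ ⥤ᵖ 𝒟) : (𝒜 × ℬ) ⥤ᵖ (𝒞 × 𝒟) where
  obj X := (P.obj X.1, Q.obj X.2)
  map f := P.map f.1 ×ₘ Q.map f.2
  map₂ η := P.map₂ η.1 ×ₘ Q.map₂ η.2
  mapId X := Iso.prod (P.mapId X.1) (Q.mapId X.2)
  mapComp f g := Iso.prod (P.mapComp f.1 g.1) (Q.mapComp f.2 g.2)

/-- The (strict) pseudofunctor `(X, Y, Z) ↦ (Y, X, Z)`. -/
def swapFst (𝒞 : Type u₁) [Bicategory.{w₁, v₁} 𝒞] :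
    (𝒞 × 𝒞 × 𝒞) ⥤ᵖ (𝒞 × 𝒞 × 𝒞) where
  obj X := (X.2.1, X.1, X.2.2)
  map f := f.2.1 ×ₘ (f.1 ×ₘ f.2.2)
  map₂ η := η.2.1 ×ₘ (η.1 ×ₘ η.2.2)
  mapId _ := Iso.refl _
  mapComp _ _ := Iso.refl _

end Products

/-! ### Squares of 1-cells filled with an invertible 2-cell -/

section Squares

open Bicategory
open scoped CategoryTheory.Prod

variable {𝒞 : Type u₁} [Bicategory.{w₁, v₁} 𝒞] {𝒟 : Type u₂} [Bicategory.{w₂, v₂} 𝒟]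

/-- Horizontal pasting of two squares. -/
def pasteSq {X₀ X₁ X₂ Y₀ Y₁ Y₂ : 𝒞} {p : X₀ ⟶ Y₀} {q : X₁ ⟶ Y₁} {r : X₂ ⟶ Y₂}
    {a : X₀ ⟶ X₁} {b : Y₀ ⟶ Y₁} {c : X₁ ⟶ X₂} {d : Y₁ ⟶ Y₂}
    (σ : p ≫ b ≅ a ≫ q) (τ : q ≫ d ≅ c ≫ r) : p ≫ (b ≫ d) ≅ (a ≫ c) ≫ r :=
  (α_ p b d).symm ≪≫ whiskerRightIso σ d ≪≫ α_ a q d ≪≫ whiskerLeftIso a τ ≪≫ (α_ a c r).symm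

/-- The image of a square under a pseudofunctor. -/
def mapSq (P : 𝒞 ⥤ᵖ 𝒟) {X X' Y Y' : 𝒞} {p : X ⟶ Y} {b : Y ⟶ Y'} {a : X ⟶ X'} {q : X' ⟶ Y'}
    (σ : p ≫ b ≅ a ≫ q) : P.map p ≫ P.map b ≅ P.map a ≫ P.map q :=
  (P.mapComp p b).symm ≪≫ P.map₂Iso σ ≪≫ P.mapComp a q

/-- The image under a pseudofunctor of an invertible 2-cell between composites of three
1-cells. -/
def map₃ (P : 𝒞 ⥤ᵖ 𝒟) {X X₁ X₂ Y₁ Y₂ Y : 𝒞} {a : X ⟶ X₁} {b : X₁ ⟶ X₂} {c : X₂ ⟶ Y}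
    {d : X ⟶ Y₁} {e : Y₁ ⟶ Y₂} {f : Y₂ ⟶ Y} (φ : a ≫ b ≫ c ≅ d ≫ e ≫ f) :
    P.map a ≫ P.map b ≫ P.map c ≅ P.map d ≫ P.map e ≫ P.map f :=
  whiskerLeftIso _ (P.mapComp b c).symm ≪≫ (P.mapComp a (b ≫ c)).symm ≪≫ P.map₂Iso φ ≪≫
    P.mapComp d (e ≫ f) ≪≫ whiskerLeftIso _ (P.mapComp e f)

/-- For a tensor product `T` and a square `σ`, the square `k ⊗ σ`, where `k` is a 1-cell placed
in the first tensor factor: it has the sides `k ⊗ p`, `1 ⊗ b`, `1 ⊗ a`, `k ⊗ q`. -/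
def tensorSq (T : (𝒞 × 𝒞) ⥤ᵖ 𝒞) {W W' : 𝒞} (k : W ⟶ W') {X X' Y Y' : 𝒞} {p : X ⟶ Y}
    {b : Y ⟶ Y'} {a : X ⟶ X'} {q : X' ⟶ Y'} (σ : p ≫ b ≅ a ≫ q) :
    T.map (k ×ₘ p) ≫ T.map (𝟙 W' ×ₘ b) ≅ T.map (𝟙 W ×ₘ a) ≫ T.map (k ×ₘ q) :=
  mapSq T (Iso.prod (ρ_ k ≪≫ (λ_ k).symm) σ)

end Squares

/-! ### Weak b-bicategories -/

section BBicategory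

open Bicategory
open scoped CategoryTheory.Prod

variable {𝒞 : Type u₁} [Bicategory.{w₁, v₁} 𝒞]

variable (𝒞) in
/-- A tensor product on a bicategory. -/
abbrev TensorProduct := (𝒞 × 𝒞) ⥤ᵖ 𝒞

/-- The functor `(X, Y, Z) ↦ X ⊗ (Y ⊗ Z)` for a tensor product `T`. -/
def tensor₃ (T : TensorProduct 𝒞) : (𝒞 × 𝒞 × 𝒞) ⥤ᵖ 𝒞 :=
  (prodMap (Pseudofunctor.id 𝒞) T).comp T

/-- The functor `(X, Y, Z) ↦ Y ⊗ (X ⊗ Z)` for a tensor product `T`. -/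
def tensor₃' (T : TensorProduct 𝒞) : (𝒞 × 𝒞 × 𝒞) ⥤ᵖ 𝒞 :=
  (swapFst 𝒞).comp (tensor₃ T)

/-- The functor `X ⊗ -`. -/
def lt (T : TensorProduct 𝒞) (X : 𝒞) : 𝒞 ⥤ᵖ 𝒞 :=
  (Bicategory.Prod.sectR X 𝒞).toPseudofunctor.comp T

variable (𝒞) in
/-- The data of a weak b-bicategory structure on a bicategory: a tensor product, pseudo-natural
1-cells `β_{X,Y,Z} : X ⊗ (Y ⊗ Z) ⟶ Y ⊗ (X ⊗ Z)` (not assumed to be equivalences) and invertible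
2-cells `γ_{X,Y,Z,W}`. -/
structure WeakBData where
  tensor : TensorProduct 𝒞
  braid : Pseudofunctor.StrongTrans (tensor₃ tensor) (tensor₃' tensor)
  γ (X Y Z W : 𝒞) :
    (braid.app (X, Y, tensor.obj (Z, W)) : _ ⟶ tensor.obj (Y, tensor.obj (X, tensor.obj (Z, W)))) ≫
        (lt tensor Y).map (braid.app (X, Z, W)) ≫ braid.app (Y, Z, tensor.obj (X, W)) ≅
      (lt tensor X).map (braid.app (Y, Z, W)) ≫
        (braid.app (X, Z, tensor.obj (Y, W)) :
          tensor.obj (X, tensor.obj (Z, tensor.obj (Y, W))) ⟶ _) ≫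
          (lt tensor Z).map (braid.app (X, Y, W))

namespace WeakBData

variable (S : WeakBData 𝒞)

/-- `X ⊗ Y` on objects. -/
abbrev ten (X Y : 𝒞) : 𝒞 := S.tensor.obj (X, Y)

/-- `f ⊗ g` on 1-cells. -/
abbrev tenHom {X X' Y Y' : 𝒞} (f : X ⟶ X') (g : Y ⟶ Y') : S.ten X Y ⟶ S.ten X' Y' :=
  S.tensor.map (f ×ₘ g)

/-- `1_X ⊗ g` on 1-cells. -/
abbrev l (X : 𝒞) {Y Y' : 𝒞} (g : Y ⟶ Y') : S.ten X Y ⟶ S.ten X Y' :=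
  (lt S.tensor X).map g

/-- The 1-cell `β_{X,Y,Z} : X ⊗ (Y ⊗ Z) ⟶ Y ⊗ (X ⊗ Z)`. -/
def β (X Y Z : 𝒞) : S.ten X (S.ten Y Z) ⟶ S.ten Y (S.ten X Z) :=
  S.braid.app (X, Y, Z)

/-- The 2-cell `γ_{X,Y,Z,W}`. -/
def hex (X Y Z W : 𝒞) :
    S.β X Y (S.ten Z W) ≫ S.l Y (S.β X Z W) ≫ S.β Y Z (S.ten X W) ≅
      S.l X (S.β Y Z W) ≫ S.β X Z (S.ten Y W) ≫ S.l Z (S.β X Y W) :=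
  S.γ X Y Z W

/-- The pseudo-naturality 2-cell of `β` at `f`, `g`, `h` (the inverse of `b_{f,g,h}`). -/
def βnat {X X' Y Y' Z Z' : 𝒞} (f : X ⟶ X') (g : Y ⟶ Y') (h : Z ⟶ Z') :
    S.tenHom f (S.tenHom g h) ≫ S.β X' Y' Z' ≅ S.β X Y Z ≫ S.tenHom g (S.tenHom f h) :=
  S.braid.naturality (a := (X, Y, Z)) (b := (X', Y', Z')) (f ×ₘ (g ×ₘ h))

/-- The pseudo-naturality 2-cell `b_{1,1,h}`, from `β ≫ (1 ⊗ (1 ⊗ h))` to `(1 ⊗ (1 ⊗ h)) ≫ β`. -/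
def b₃ (X Y : 𝒞) {Z Z' : 𝒞} (h : Z ⟶ Z') :
    S.β X Y Z ≫ S.l Y (S.l X h) ≅ S.l X (S.l Y h) ≫ S.β X Y Z' :=
  (S.βnat (𝟙 X) (𝟙 Y) h).symm

/-- `1_V ⊗ γ_{X,Y,Z,W}`. -/
def lhex (V X Y Z W : 𝒞) :
    S.l V (S.β X Y (S.ten Z W)) ≫ S.l V (S.l Y (S.β X Z W)) ≫ S.l V (S.β Y Z (S.ten X W)) ≅
      S.l V (S.l X (S.β Y Z W)) ≫ S.l V (S.β X Z (S.ten Y W)) ≫ S.l V (S.l Z (S.β X Y W)) :=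
  map₃ (lt S.tensor V) (S.hex X Y Z W)

/-- Naturality of `γ` in its four arguments: `γ` is a modification. -/
def HexNatural : Prop :=
  ∀ ⦃X X' Y Y' Z Z' W W' : 𝒞⦄ (f : X ⟶ X') (g : Y ⟶ Y') (h : Z ⟶ Z') (k : W ⟶ W'),
    S.tenHom f (S.tenHom g (S.tenHom h k)) ◁ (S.hex X' Y' Z' W').hom ≫
        (pasteSq (tensorSq S.tensor f (S.βnat g h k))
          (pasteSq (S.βnat f h (S.tenHom g k)) (tensorSq S.tensor h (S.βnat f g k)))).hom =
      (pasteSq (S.βnat f g (S.tenHom h k))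
          (pasteSq (tensorSq S.tensor g (S.βnat f h k)) (S.βnat g h (S.tenHom f k)))).hom ≫
        (S.hex X Y Z W).hom ▷ S.tenHom h (S.tenHom g (S.tenHom f k))

/-- The left boundary of the coherence condition for `γ`: a path of six 1-cells. -/
abbrev leftPath (X Y Z U V : 𝒞) :
    S.ten X (S.ten Y (S.ten Z (S.ten U V))) ⟶ S.ten U (S.ten Z (S.ten Y (S.ten X V))) :=
  S.β X Y (S.ten Z (S.ten U V)) ≫ S.l Y (S.β X Z (S.ten U V)) ≫ S.l Y (S.l Z (S.β X U V)) ≫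
    S.β Y Z (S.ten U (S.ten X V)) ≫ S.l Z (S.β Y U (S.ten X V)) ≫ S.β Z U (S.ten Y (S.ten X V))

/-- The right boundary of the coherence condition for `γ`. -/
abbrev rightPath (X Y Z U V : 𝒞) :
    S.ten X (S.ten Y (S.ten Z (S.ten U V))) ⟶ S.ten U (S.ten Z (S.ten Y (S.ten X V))) :=
  S.l X (S.l Y (S.β Z U V)) ≫ S.l X (S.β Y U (S.ten Z V)) ≫ S.l X (S.l U (S.β Y Z V)) ≫
    S.β X U (S.ten Z (S.ten Y V)) ≫ S.l U (S.β X Z (S.ten Y V)) ≫ S.l U (S.l Z (S.β X Y V))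

/-- The first pasting of 2-cells in the coherence condition for `γ`. -/
def pasting₁ (X Y Z U V : 𝒞) : S.leftPath X Y Z U V ⟶ S.rightPath X Y Z U V :=
  𝟙 _ ⊗≫
    (S.β X Y (S.ten Z (S.ten U V)) ≫ S.l Y (S.β X Z (S.ten U V)) ≫ S.l Y (S.l Z (S.β X U V))) ◁
      (S.hex Y Z U (S.ten X V)).hom ⊗≫
    S.β X Y (S.ten Z (S.ten U V)) ◁ (S.lhex Y X Z U V).hom ▷
      (S.β Y U (S.ten Z (S.ten X V)) ≫ S.l U (S.β Y Z (S.ten X V))) ⊗≫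
    (S.b₃ X Y (S.β Z U V)).hom ▷
      (S.l Y (S.β X U (S.ten Z V)) ≫ S.l Y (S.l U (S.β X Z V)) ≫
        S.β Y U (S.ten Z (S.ten X V)) ≫ S.l U (S.β Y Z (S.ten X V))) ⊗≫
    (S.l X (S.l Y (S.β Z U V)) ≫ S.β X Y (S.ten U (S.ten Z V)) ≫ S.l Y (S.β X U (S.ten Z V))) ◁
      (S.b₃ Y U (S.β X Z V)).inv ▷ S.l U (S.β Y Z (S.ten X V)) ⊗≫
    S.l X (S.l Y (S.β Z U V)) ◁ (S.hex X Y U (S.ten Z V)).hom ▷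
      (S.l U (S.l Y (S.β X Z V)) ≫ S.l U (S.β Y Z (S.ten X V))) ⊗≫
    (S.l X (S.l Y (S.β Z U V)) ≫ S.l X (S.β Y U (S.ten Z V)) ≫ S.β X U (S.ten Y (S.ten Z V))) ◁
      (S.lhex U X Y Z V).hom ⊗≫
    (S.l X (S.l Y (S.β Z U V)) ≫ S.l X (S.β Y U (S.ten Z V))) ◁ (S.b₃ X U (S.β Y Z V)).hom ▷
      (S.l U (S.β X Z (S.ten Y V)) ≫ S.l U (S.l Z (S.β X Y V))) ⊗≫
    𝟙 _

/-- The second pasting of 2-cells in the coherence condition for `γ`. -/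
def pasting₂ (X Y Z U V : 𝒞) : S.leftPath X Y Z U V ⟶ S.rightPath X Y Z U V :=
  𝟙 _ ⊗≫
    (S.β X Y (S.ten Z (S.ten U V)) ≫ S.l Y (S.β X Z (S.ten U V))) ◁
      (S.b₃ Y Z (S.β X U V)).inv ▷
      (S.l Z (S.β Y U (S.ten X V)) ≫ S.β Z U (S.ten Y (S.ten X V))) ⊗≫
    (S.hex X Y Z (S.ten U V)).hom ▷
      (S.l Z (S.l Y (S.β X U V)) ≫ S.l Z (S.β Y U (S.ten X V)) ≫
        S.β Z U (S.ten Y (S.ten X V))) ⊗≫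
    (S.l X (S.β Y Z (S.ten U V)) ≫ S.β X Z (S.ten Y (S.ten U V))) ◁ (S.lhex Z X Y U V).hom ▷
      S.β Z U (S.ten Y (S.ten X V)) ⊗≫
    S.l X (S.β Y Z (S.ten U V)) ◁ (S.b₃ X Z (S.β Y U V)).hom ▷
      (S.l Z (S.β X U (S.ten Y V)) ≫ S.l Z (S.l U (S.β X Y V)) ≫
        S.β Z U (S.ten Y (S.ten X V))) ⊗≫
    (S.l X (S.β Y Z (S.ten U V)) ≫ S.l X (S.l Z (S.β Y U V)) ≫ S.β X Z (S.ten U (S.ten Y V)) ≫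
      S.l Z (S.β X U (S.ten Y V))) ◁ (S.b₃ Z U (S.β X Y V)).inv ⊗≫
    (S.l X (S.β Y Z (S.ten U V)) ≫ S.l X (S.l Z (S.β Y U V))) ◁ (S.hex X Z U (S.ten Y V)).hom ▷
      S.l U (S.l Z (S.β X Y V)) ⊗≫
    (S.lhex X Y Z U V).hom ▷
      (S.β X U (S.ten Z (S.ten Y V)) ≫ S.l U (S.β X Z (S.ten Y V)) ≫
        S.l U (S.l Z (S.β X Y V))) ⊗≫
    𝟙 _

end WeakBData

variable (𝒞) in
/-- A weak b-bicategory structure on a bicategory. -/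
structure WeakBBicategory extends WeakBData 𝒞 where
  hex_natural : toWeakBData.HexNatural
  coherence : ∀ X Y Z U V : 𝒞, toWeakBData.pasting₁ X Y Z U V = toWeakBData.pasting₂ X Y Z U V

end BBicategory

/-! ### Weak b-functors -/

section BFunctor

open Bicategory
open scoped CategoryTheory.Prod

variable {𝒞 : Type u₁} [Bicategory.{w₁, v₁} 𝒞] {𝒟 : Type u₂} [Bicategory.{w₂, v₂} 𝒟]

/-- Pseudo-natural 1-cells `F_{X,Y} : F(X ⊗ Y) ⟶ F(X) ⊗ F(Y)` (not assumed to be equivalences). -/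
abbrev Comparison (S : WeakBData 𝒞) (R : WeakBData 𝒟) (F : 𝒞 ⥤ᵖ 𝒟) :=
  Pseudofunctor.StrongTrans (S.tensor.comp F) ((prodMap F F).comp R.tensor)

namespace Comparison

variable {S : WeakBData 𝒞} {R : WeakBData 𝒟} {F : 𝒞 ⥤ᵖ 𝒟} (C : Comparison S R F)

/-- The 1-cell `F_{X,Y}`. -/
def at₂ (X Y : 𝒞) : F.obj (S.ten X Y) ⟶ R.ten (F.obj X) (F.obj Y) := C.app (X, Y)

/-- The pseudo-naturality 2-cell of `F_{-,-}` at `f`, `g`. -/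
def nat {X X' Y Y' : 𝒞} (f : X ⟶ X') (g : Y ⟶ Y') :
    F.map (S.tenHom f g) ≫ C.at₂ X' Y' ≅ C.at₂ X Y ≫ R.tenHom (F.map f) (F.map g) :=
  C.naturality (a := (X, Y)) (b := (X', Y')) (f ×ₘ g)

/-- The pseudo-naturality 2-cell of `F_{-,-}` in the second argument. -/
def nat₂ (X : 𝒞) {Y Y' : 𝒞} (g : Y ⟶ Y') :
    F.map (S.l X g) ≫ C.at₂ X Y' ≅ C.at₂ X Y ≫ R.l (F.obj X) (F.map g) :=
  C.nat (𝟙 X) g ≪≫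
    whiskerLeftIso _ (R.tensor.map₂Iso (Iso.prod (F.mapId X) (Iso.refl (F.map g))))

end Comparison

/-- The data of a weak b-functor structure on `F`: the pseudo-natural 1-cells `F_{X,Y}` and the
invertible 2-cells `φ_{X,Y,Z}`. -/
structure WeakBFunctorData (S : WeakBData 𝒞) (R : WeakBData 𝒟) (F : 𝒞 ⥤ᵖ 𝒟) where
  cmp : Comparison S R F
  φ (X Y Z : 𝒞) :
    F.map (S.β X Y Z) ≫ cmp.at₂ Y (S.ten X Z) ≫ R.l (F.obj Y) (cmp.at₂ X Z) ≅
      cmp.at₂ X (S.ten Y Z) ≫ R.l (F.obj X) (cmp.at₂ Y Z) ≫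
        R.β (F.obj X) (F.obj Y) (F.obj Z)

namespace WeakBFunctorData

variable {S : WeakBData 𝒞} {R : WeakBData 𝒟} {F : 𝒞 ⥤ᵖ 𝒟} (Φ : WeakBFunctorData S R F)

/-- Naturality of `φ` in its three arguments: `φ` is a modification. -/
def Natural : Prop :=
  ∀ ⦃X X' Y Y' Z Z' : 𝒞⦄ (f : X ⟶ X') (g : Y ⟶ Y') (h : Z ⟶ Z'),
    F.map (S.tenHom f (S.tenHom g h)) ◁ (Φ.φ X' Y' Z').hom ≫
        (pasteSq (Φ.cmp.nat f (S.tenHom g h))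
          (pasteSq (tensorSq R.tensor (F.map f) (Φ.cmp.nat g h))
            (R.βnat (F.map f) (F.map g) (F.map h)))).hom =
      (pasteSq (mapSq F (S.βnat f g h))
          (pasteSq (Φ.cmp.nat g (S.tenHom f h))
            (tensorSq R.tensor (F.map g) (Φ.cmp.nat f h)))).hom ≫
        (Φ.φ X Y Z).hom ▷ R.tenHom (F.map g) (R.tenHom (F.map f) (F.map h))

/-- `1_V ⊗ φ_{X,Y,Z}`. -/
def lφ (V : 𝒟) (X Y Z : 𝒞) :
    R.l V (F.map (S.β X Y Z)) ≫ R.l V (Φ.cmp.at₂ Y (S.ten X Z)) ≫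
        R.l V (R.l (F.obj Y) (Φ.cmp.at₂ X Z)) ≅
      R.l V (Φ.cmp.at₂ X (S.ten Y Z)) ≫ R.l V (R.l (F.obj X) (Φ.cmp.at₂ Y Z)) ≫
        R.l V (R.β (F.obj X) (F.obj Y) (F.obj Z)) :=
  map₃ (lt R.tensor V) (Φ.φ X Y Z)

/-- The first boundary path of the coherence condition for `φ`. -/
abbrev srcPath (X Y Z W : 𝒞) :
    F.obj (S.ten X (S.ten Y (S.ten Z W))) ⟶
      R.ten (F.obj Z) (R.ten (F.obj Y) (R.ten (F.obj X) (F.obj W))) :=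
  F.map (S.β X Y (S.ten Z W)) ≫ F.map (S.l Y (S.β X Z W)) ≫ F.map (S.β Y Z (S.ten X W)) ≫
    Φ.cmp.at₂ Z (S.ten Y (S.ten X W)) ≫ R.l (F.obj Z) (Φ.cmp.at₂ Y (S.ten X W)) ≫
      R.l (F.obj Z) (R.l (F.obj Y) (Φ.cmp.at₂ X W))

/-- The second boundary path of the coherence condition for `φ`. -/
abbrev tgtPath (X Y Z W : 𝒞) :
    F.obj (S.ten X (S.ten Y (S.ten Z W))) ⟶
      R.ten (F.obj Z) (R.ten (F.obj Y) (R.ten (F.obj X) (F.obj W))) :=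
  Φ.cmp.at₂ X (S.ten Y (S.ten Z W)) ≫ R.l (F.obj X) (Φ.cmp.at₂ Y (S.ten Z W)) ≫
    R.l (F.obj X) (R.l (F.obj Y) (Φ.cmp.at₂ Z W)) ≫
      R.l (F.obj X) (R.β (F.obj Y) (F.obj Z) (F.obj W)) ≫
        R.β (F.obj X) (F.obj Z) (R.ten (F.obj Y) (F.obj W)) ≫
          R.l (F.obj Z) (R.β (F.obj X) (F.obj Y) (F.obj W))

/-- The first pasting of 2-cells in the coherence condition for `φ`. -/
def pasting₁ (X Y Z W : 𝒞) : Φ.srcPath X Y Z W ⟶ Φ.tgtPath X Y Z W :=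
  𝟙 _ ⊗≫
    (map₃ F (S.hex X Y Z W)).hom ▷
      (Φ.cmp.at₂ Z (S.ten Y (S.ten X W)) ≫ R.l (F.obj Z) (Φ.cmp.at₂ Y (S.ten X W)) ≫
        R.l (F.obj Z) (R.l (F.obj Y) (Φ.cmp.at₂ X W))) ⊗≫
    (F.map (S.l X (S.β Y Z W)) ≫ F.map (S.β X Z (S.ten Y W))) ◁
      (Φ.cmp.nat₂ Z (S.β X Y W)).hom ▷
      (R.l (F.obj Z) (Φ.cmp.at₂ Y (S.ten X W)) ≫
        R.l (F.obj Z) (R.l (F.obj Y) (Φ.cmp.at₂ X W))) ⊗≫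
    (F.map (S.l X (S.β Y Z W)) ≫ F.map (S.β X Z (S.ten Y W)) ≫
      Φ.cmp.at₂ Z (S.ten X (S.ten Y W))) ◁ (Φ.lφ (F.obj Z) X Y W).hom ⊗≫
    F.map (S.l X (S.β Y Z W)) ◁ (Φ.φ X Z (S.ten Y W)).hom ▷
      (R.l (F.obj Z) (R.l (F.obj X) (Φ.cmp.at₂ Y W)) ≫
        R.l (F.obj Z) (R.β (F.obj X) (F.obj Y) (F.obj W))) ⊗≫
    (Φ.cmp.nat₂ X (S.β Y Z W)).hom ▷
      (R.l (F.obj X) (Φ.cmp.at₂ Z (S.ten Y W)) ≫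
        R.β (F.obj X) (F.obj Z) (F.obj (S.ten Y W)) ≫
          R.l (F.obj Z) (R.l (F.obj X) (Φ.cmp.at₂ Y W)) ≫
            R.l (F.obj Z) (R.β (F.obj X) (F.obj Y) (F.obj W))) ⊗≫
    (Φ.cmp.at₂ X (S.ten Y (S.ten Z W)) ≫ R.l (F.obj X) (F.map (S.β Y Z W)) ≫
      R.l (F.obj X) (Φ.cmp.at₂ Z (S.ten Y W))) ◁
      (R.b₃ (F.obj X) (F.obj Z) (Φ.cmp.at₂ Y W)).hom ▷
      R.l (F.obj Z) (R.β (F.obj X) (F.obj Y) (F.obj W)) ⊗≫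
    Φ.cmp.at₂ X (S.ten Y (S.ten Z W)) ◁ (Φ.lφ (F.obj X) Y Z W).hom ▷
      (R.β (F.obj X) (F.obj Z) (R.ten (F.obj Y) (F.obj W)) ≫
        R.l (F.obj Z) (R.β (F.obj X) (F.obj Y) (F.obj W))) ⊗≫
    𝟙 _

/-- The second pasting of 2-cells in the coherence condition for `φ`. -/
def pasting₂ (X Y Z W : 𝒞) : Φ.srcPath X Y Z W ⟶ Φ.tgtPath X Y Z W :=
  𝟙 _ ⊗≫
    (F.map (S.β X Y (S.ten Z W)) ≫ F.map (S.l Y (S.β X Z W))) ◁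
      (Φ.φ Y Z (S.ten X W)).hom ▷ R.l (F.obj Z) (R.l (F.obj Y) (Φ.cmp.at₂ X W)) ⊗≫
    F.map (S.β X Y (S.ten Z W)) ◁ (Φ.cmp.nat₂ Y (S.β X Z W)).hom ▷
      (R.l (F.obj Y) (Φ.cmp.at₂ Z (S.ten X W)) ≫
        R.β (F.obj Y) (F.obj Z) (F.obj (S.ten X W)) ≫
          R.l (F.obj Z) (R.l (F.obj Y) (Φ.cmp.at₂ X W))) ⊗≫
    (F.map (S.β X Y (S.ten Z W)) ≫ Φ.cmp.at₂ Y (S.ten X (S.ten Z W)) ≫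
      R.l (F.obj Y) (F.map (S.β X Z W)) ≫ R.l (F.obj Y) (Φ.cmp.at₂ Z (S.ten X W))) ◁
      (R.b₃ (F.obj Y) (F.obj Z) (Φ.cmp.at₂ X W)).hom ⊗≫
    (F.map (S.β X Y (S.ten Z W)) ≫ Φ.cmp.at₂ Y (S.ten X (S.ten Z W))) ◁
      (Φ.lφ (F.obj Y) X Z W).hom ▷
      R.β (F.obj Y) (F.obj Z) (R.ten (F.obj X) (F.obj W)) ⊗≫
    (Φ.φ X Y (S.ten Z W)).hom ▷
      (R.l (F.obj Y) (R.l (F.obj X) (Φ.cmp.at₂ Z W)) ≫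
        R.l (F.obj Y) (R.β (F.obj X) (F.obj Z) (F.obj W)) ≫
          R.β (F.obj Y) (F.obj Z) (R.ten (F.obj X) (F.obj W))) ⊗≫
    (Φ.cmp.at₂ X (S.ten Y (S.ten Z W)) ≫ R.l (F.obj X) (Φ.cmp.at₂ Y (S.ten Z W))) ◁
      (R.b₃ (F.obj X) (F.obj Y) (Φ.cmp.at₂ Z W)).hom ▷
      (R.l (F.obj Y) (R.β (F.obj X) (F.obj Z) (F.obj W)) ≫
        R.β (F.obj Y) (F.obj Z) (R.ten (F.obj X) (F.obj W))) ⊗≫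
    (Φ.cmp.at₂ X (S.ten Y (S.ten Z W)) ≫ R.l (F.obj X) (Φ.cmp.at₂ Y (S.ten Z W)) ≫
      R.l (F.obj X) (R.l (F.obj Y) (Φ.cmp.at₂ Z W))) ◁
      (R.hex (F.obj X) (F.obj Y) (F.obj Z) (F.obj W)).hom ⊗≫
    𝟙 _

/-- The coherence condition for `φ`. -/
def Coherent : Prop := ∀ X Y Z W : 𝒞, Φ.pasting₁ X Y Z W = Φ.pasting₂ X Y Z W

end WeakBFunctorData

/-- A weak b-functor structure on the pseudofunctor `F` between weak b-bicategories. -/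
structure WeakBFunctor (S : WeakBBicategory 𝒞) (R : WeakBBicategory 𝒟) (F : 𝒞 ⥤ᵖ 𝒟) extends
    WeakBFunctorData S.toWeakBData R.toWeakBData F where
  natural : toWeakBFunctorData.Natural
  coherent : toWeakBFunctorData.Coherent

end BFunctor

/-! ### The one-object case

`MonoidalSingleObj E` is the bicategory with one object `⋆`, with category of endomorphisms the
monoidal category `E`; the composite `f ≫ g` of 1-cells is `f ⊗ g` in `E`. -/

section OneObject

open MonoidalCategory

variable {E : Type u} [Category.{v} E] [MonoidalCategory E]

variable (E) in
/-- The unique object. -/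
abbrev pt : MonoidalSingleObj E := MonoidalSingleObj.star E

/-- The object `1 ⊗ f` of `E`. -/
def lObj (T : TensorProduct (MonoidalSingleObj E)) (f : E) : E :=
  (lt T (pt E)).map (X := pt E) (Y := pt E) f

/-- The morphism `1 ⊗ η` of `E`. -/
def lMap (T : TensorProduct (MonoidalSingleObj E)) {f g : E}
    (η : f ⟶ g) : lObj T f ⟶ lObj T g :=
  (lt T (pt E)).map₂ (a := pt E) (b := pt E) η

/-- The structure isomorphism comparing `1 ⊗ (f ≫ g)` and `(1 ⊗ f) ≫ (1 ⊗ g)`. -/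
def lComp (T : TensorProduct (MonoidalSingleObj E)) (f g : E) :
    lObj T (f ⊗ g) ≅ lObj T f ⊗ lObj T g :=
  (lt T (pt E)).mapComp (a := pt E) (b := pt E) (c := pt E) f g

/-- The structure isomorphism comparing `1 ⊗ 1` and `1`. -/
def lId (T : TensorProduct (MonoidalSingleObj E)) :
    lObj T (𝟙_ E) ≅ 𝟙_ E :=
  (lt T (pt E)).mapId (pt E)

/-- An identification of the functor `⋆ ⊗ -` with the identity functor: natural isomorphisms
`1 ⊗ f ≅ f` in `E`, compatible with composition and identities of 1-cells. -/
structure UnitIdentification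
    (T : TensorProduct (MonoidalSingleObj E)) where
  iso (f : E) : lObj T f ≅ f
  naturality {f g : E} (η : f ⟶ g) : lMap T η ≫ (iso g).hom = (iso f).hom ≫ η
  comp (f g : E) : (lComp T f g).hom ≫ ((iso f).hom ⊗ₘ (iso g).hom) = (iso (f ⊗ g)).hom
  unit : (lId T).hom = (iso (𝟙_ E)).hom

/-- A morphism `X ⊗ Y ≅ Y' ⊗ X'` applied to the first two factors. -/
def onTwo {X Y X' Y' : E} (t : X ⊗ Y ≅ Y' ⊗ X') (W : E) : X ⊗ Y ⊗ W ≅ Y' ⊗ X' ⊗ W :=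
  (α_ X Y W).symm ≪≫ whiskerRightIso t W ≪≫ α_ Y' X' W

/-- An automorphism of `X ⊗ Y ⊗ Z` applied to the first three factors. -/
def onThree {X Y Z : E} (L : X ⊗ Y ⊗ Z ≅ X ⊗ Y ⊗ Z) (W : E) : X ⊗ Y ⊗ Z ⊗ W ≅ X ⊗ Y ⊗ Z ⊗ W :=
  whiskerLeftIso X (α_ Y Z W).symm ≪≫ (α_ X (Y ⊗ Z) W).symm ≪≫ whiskerRightIso L W ≪≫
    α_ X (Y ⊗ Z) W ≪≫ whiskerLeftIso X (α_ Y Z W)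

/-- The conjugate `c⁻¹ e c` of an automorphism (in functional notation). -/
def conjBy {P Q : E} (c : P ≅ Q) (e : Q ≅ Q) : P ≅ P := c ≪≫ e ≪≫ c.symm

/-- The composite `t₁ t₂ t₁ : X ⊗ Y ⊗ Z ≅ Z ⊗ Y ⊗ X` of isomorphisms exchanging neighbouring
factors. -/
def reversal {X Y Z : E} (tXY : X ⊗ Y ≅ Y ⊗ X) (tXZ : X ⊗ Z ≅ Z ⊗ X) (tYZ : Y ⊗ Z ≅ Z ⊗ Y) :
    X ⊗ Y ⊗ Z ≅ Z ⊗ Y ⊗ X :=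
  onTwo tXY Z ≪≫ whiskerLeftIso Y tXZ ≪≫ onTwo tYZ X

variable (S : WeakBData (MonoidalSingleObj E)) (u : UnitIdentification S.tensor)

/-- The object `B = β_{⋆,⋆,⋆}` of `E`. -/
def objB : E := S.β (pt E) (pt E) (pt E)

/-- The identification `1 ⊗ (1 ⊗ X) ≅ X`. -/
def ident₂ (X : E) : lObj S.tensor (lObj S.tensor X) ≅ X := u.iso _ ≪≫ u.iso X

/-- The half-braiding `t_{B,X} : B ⊗ X ≅ X ⊗ B`, the pseudo-naturality 2-cell `b_{1,1,X}` of
`β`. -/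
def tB (X : E) : objB S ⊗ X ≅ X ⊗ objB S :=
  whiskerLeftIso (objB S) (ident₂ S u X).symm ≪≫
    (S.b₃ (pt E) (pt E) (Z := pt E) (Z' := pt E) X :
      objB S ⊗ lObj S.tensor (lObj S.tensor X) ≅ lObj S.tensor (lObj S.tensor X) ⊗ objB S) ≪≫
    whiskerRightIso (ident₂ S u X) (objB S)

/-- The automorphism of `B ⊗ B ⊗ B` given by the 2-cell `γ_{⋆,⋆,⋆,⋆}`. -/
def autS : objB S ⊗ objB S ⊗ objB S ≅ objB S ⊗ objB S ⊗ objB S :=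
  whiskerLeftIso (objB S) (whiskerRightIso (u.iso (objB S)).symm (objB S)) ≪≫
    (S.hex (pt E) (pt E) (pt E) (pt E) :
      objB S ⊗ lObj S.tensor (objB S) ⊗ objB S ≅
        lObj S.tensor (objB S) ⊗ objB S ⊗ lObj S.tensor (objB S)) ≪≫
    ((u.iso (objB S)) ⊗ᵢ (whiskerLeftIso (objB S) (u.iso (objB S))))

/-- The automorphism `Z` of `B ⊗ B ⊗ B`, determined by `γ_{⋆,⋆,⋆,⋆} = t₁ t₂ t₁ Z`. -/
def autZ : objB S ⊗ objB S ⊗ objB S ≅ objB S ⊗ objB S ⊗ objB S :=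
  autS S u ≪≫ (reversal (tB S u (objB S)) (tB S u (objB S)) (tB S u (objB S))).symm

/-- Pseudo-natural 1-cells `X ⊗ Y ⟶ X ⊗ Y`, for the identity functor; in the one-object case, an
object `C` of `E` with its pseudo-naturality cells (half-braidings). -/
abbrev IdComparison := Comparison S S (Pseudofunctor.id (MonoidalSingleObj E))

variable {S} in
/-- The object `C` of `E`. -/
def objC (C : IdComparison S) : E := C.at₂ (pt E) (pt E)

variable {S} in
/-- The half-braiding `t_{C,X} : C ⊗ X ≅ X ⊗ C`, the pseudo-naturality 2-cell at `(1, X)`. -/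
def tC (C : IdComparison S) (X : E) : objC C ⊗ X ≅ X ⊗ objC C :=
  whiskerLeftIso (objC C) (u.iso X).symm ≪≫
    (C.nat₂ (pt E) (Y := pt E) (Y' := pt E) X :
      lObj S.tensor X ⊗ objC C ≅ objC C ⊗ lObj S.tensor X).symm ≪≫
    whiskerRightIso (u.iso X) (objC C)

variable {S} in
/-- The half-braidings `t_{B,C}` and `t_{C,B}` are inverse to each other and `t_{C,C}² = 1`. -/
def SymmetricHalfBraidings (C : IdComparison S) : Prop :=
  tB S u (objC C) ≪≫ tC u C (objB S) = Iso.refl _ ∧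
    tC u C (objB S) ≪≫ tB S u (objC C) = Iso.refl _ ∧
    tC u C (objC C) ≪≫ tC u C (objC C) = Iso.refl _

/-- A pair `(C, L)`. -/
structure Pair where
  C : IdComparison S
  L : objC C ⊗ objC C ⊗ objB S ≅ objC C ⊗ objC C ⊗ objB S

variable {S}

/-- The isomorphism `t₁ t₂ t₁ : B ⊗ C ⊗ C ≅ C ⊗ C ⊗ B`. -/
def reversalBCC (C : IdComparison S) :
    objB S ⊗ objC C ⊗ objC C ≅ objC C ⊗ objC C ⊗ objB S :=
  reversal (tB S u (objC C)) (tB S u (objC C)) (tC u C (objC C))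

/-- A 2-cell `M : B ⊗ C ⊗ C ≅ C ⊗ C ⊗ B` viewed as a 2-cell of the shape of `φ_{⋆,⋆,⋆}`, and
vice versa. -/
def cellEquiv (C : IdComparison S) :
    (objB S ⊗ objC C ⊗ lObj S.tensor (objC C) ≅
        objC C ⊗ lObj S.tensor (objC C) ⊗ objB S) ≃
      (objB S ⊗ objC C ⊗ objC C ≅ objC C ⊗ objC C ⊗ objB S) :=
  (whiskerLeftIso (objB S) (whiskerLeftIso (objC C) (u.iso (objC C)))).isoCongr
    (whiskerLeftIso (objC C) (whiskerRightIso (u.iso (objC C)) (objB S)))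

/-- The isomorphism `M : B ⊗ C ⊗ C ≅ C ⊗ C ⊗ B` given by the 2-cell `φ_{⋆,⋆,⋆}`. -/
def cellM (Φ : WeakBFunctorData S S (Pseudofunctor.id (MonoidalSingleObj E))) :
    objB S ⊗ objC Φ.cmp ⊗ objC Φ.cmp ≅ objC Φ.cmp ⊗ objC Φ.cmp ⊗ objB S :=
  cellEquiv u Φ.cmp (Φ.φ (pt E) (pt E) (pt E))

/-- The pair `(C, L)` with `L = t₁ t₂ t₁ M⁻¹`. -/
def toPair (Φ : WeakBFunctorData S S (Pseudofunctor.id (MonoidalSingleObj E))) : Pair S where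
  C := Φ.cmp
  L := (cellM u Φ).symm ≪≫ reversalBCC u Φ.cmp

/-- The object `C ⊗ C ⊗ C ⊗ B ⊗ B ⊗ B`. -/
abbrev C₃B₃ (C : IdComparison S) : E :=
  objC C ⊗ objC C ⊗ objC C ⊗ objB S ⊗ objB S ⊗ objB S

namespace Pair

variable (p : Pair S)

/-- The invertible 2-cells of the shape of `φ` corresponding to the isomorphism
`M = L⁻¹ t₁ t₂ t₁ : B ⊗ C ⊗ C ≅ C ⊗ C ⊗ B`. -/
def toData : WeakBFunctorData S S (Pseudofunctor.id (MonoidalSingleObj E)) where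
  cmp := p.C
  φ _ _ _ := (cellEquiv u p.C).symm (reversalBCC u p.C ≪≫ p.L.symm)

/-- The isomorphism `M = L⁻¹ t₁ t₂ t₁ : B ⊗ C ⊗ C ≅ C ⊗ C ⊗ B` is compatible with the
pseudo-naturality cells of `B` and `C`. -/
def Natural : Prop := (p.toData u).Natural

/-- `L₁₂₄ = t₃⁻¹ L₁₂₃ t₃`, an automorphism of `C ⊗ C ⊗ C ⊗ B ⊗ B ⊗ B`. -/
def L₁₂₄ : C₃B₃ p.C ≅ C₃B₃ p.C :=
  conjBy
    (whiskerLeftIso (objC p.C) (whiskerLeftIso (objC p.C)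
      (onTwo (tC u p.C (objB S)) (objB S ⊗ objB S))))
    (onThree p.L (objC p.C ⊗ objB S ⊗ objB S))

/-- `L₁₃₅ = (t₃ t₄ t₂)⁻¹ L₁₂₃ (t₃ t₄ t₂)`, an automorphism of `C ⊗ C ⊗ C ⊗ B ⊗ B ⊗ B`. -/
def L₁₃₅ : C₃B₃ p.C ≅ C₃B₃ p.C :=
  conjBy
    (whiskerLeftIso (objC p.C) (onTwo (tC u p.C (objC p.C)) (objB S ⊗ objB S ⊗ objB S)) ≪≫
      whiskerLeftIso (objC p.C) (whiskerLeftIso (objC p.C) (whiskerLeftIso (objC p.C)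
        (onTwo (tB S u (objB S)) (objB S)))) ≪≫
      whiskerLeftIso (objC p.C) (whiskerLeftIso (objC p.C)
        (onTwo (tC u p.C (objB S)) (objB S ⊗ objB S))))
    (onThree p.L (objC p.C ⊗ objB S ⊗ objB S))

/-- `L₂₃₆ = (t₄ t₅)⁻¹ L₂₃₄ (t₄ t₅)`, an automorphism of `C ⊗ C ⊗ C ⊗ B ⊗ B ⊗ B`. -/
def L₂₃₆ : C₃B₃ p.C ≅ C₃B₃ p.C :=
  conjBy
    (whiskerLeftIso (objC p.C) (whiskerLeftIso (objC p.C) (whiskerLeftIso (objC p.C)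
        (whiskerLeftIso (objB S) (tB S u (objB S))))) ≪≫
      whiskerLeftIso (objC p.C) (whiskerLeftIso (objC p.C) (whiskerLeftIso (objC p.C)
        (onTwo (tB S u (objB S)) (objB S)))))
    (whiskerLeftIso (objC p.C) (onThree p.L (objB S ⊗ objB S)))

/-- `Z₄₅₆`, an automorphism of `C ⊗ C ⊗ C ⊗ B ⊗ B ⊗ B`. -/
def Z₄₅₆ : C₃B₃ p.C ≅ C₃B₃ p.C :=
  whiskerLeftIso (objC p.C) (whiskerLeftIso (objC p.C) (whiskerLeftIso (objC p.C) (autZ S u)))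

/-- The relation `L₁₂₄ L₁₃₅ L₂₃₆ Z₄₅₆ = Z₄₅₆ L₂₃₆ L₁₃₅ L₁₂₄`; in a product the right-most factor
is applied first, while `≪≫` composes from left to right. -/
def Relation : Prop :=
  p.Z₄₅₆ u ≪≫ p.L₂₃₆ u ≪≫ p.L₁₃₅ u ≪≫ p.L₁₂₄ u =
    p.L₁₂₄ u ≪≫ p.L₁₃₅ u ≪≫ p.L₂₃₆ u ≪≫ p.Z₄₅₆ u

end Pair

end OneObject

end BBicat

/-! Since `t₁t₂t₁` is invertible, `φ` and `L` determine each other. The assignment is therefore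
bijective on all data, and naturality on the side of pairs is by definition naturality of the
reconstructed `φ`. What remains is that, for admissible `C`, coherence of `φ` is equivalent to the
relation for `L` (`coherent_iff_relation`).

With one object, coherence is a single equation between two composites from `B³C³` to `C³B³`
(`coherent_iff`), each made of one `S`, three `M` and three half-braidings. Substituting `S =
t₁t₂t₁Z` and `M = N t₁t₂t₁` with `N = L⁻¹` (right-to-left products), both become words in crossings
of adjacent strands and coupons `N`, `Z` on three adjacent strands. Naturality and multiplicativity
of the half-braidings give the braid relations and let a strand slide past a coupon. Admissibility
and `t_{B,B}² = 1` make the crossings involutions, so that a word without coupons depends only on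
its permutation.

Moving crossings away from the coupons writes both composites, in diagrammatic order, as `g`, then
coupons, then `r`: `g` carries `BBBCCC` to `CCCBBB` and `r` reverses the last three strands. The
coupons in between are `Z₄₅₆` and the inverses of `L₁₂₄`, `L₁₃₅`, `L₂₃₆`, in opposite orders in the
two composites (`six_strand_identity`). Cancelling `g` and `r` and inverting yields the relation.

The bookkeeping of types is removed by `Operator`: a crossing acts on all words in `B` and `C` at
once, so that the computation takes place in a monoid. `six_strand_equation` returns to morphisms by
evaluating at `BBBCCC`. -/

open CategoryTheory

namespace BBicat

universe w₁ v₁ u₁ v u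

/-! ### Operators on words of strands -/

section StrandCalculus

open MonoidalCategory
variable {E : Type u} [Category.{v} E] [MonoidalCategory E]

/-- A morphism between threefold tensor products, applied to the first three factors. -/
def tripleWhisker {X Y Z X' Y' Z' : E} (f : X ⊗ Y ⊗ Z ⟶ X' ⊗ Y' ⊗ Z') (W : E) :
    X ⊗ Y ⊗ Z ⊗ W ⟶ X' ⊗ Y' ⊗ Z' ⊗ W :=
  X ◁ (α_ Y Z W).inv ≫ (α_ X (Y ⊗ Z) W).inv ≫ f ▷ W ≫ (α_ X' (Y' ⊗ Z') W).hom ≫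
    X' ◁ (α_ Y' Z' W).hom

/-- A morphism between twofold tensor products, applied to the first two factors. -/
def doubleWhisker {X Y X' Y' : E} (f : X ⊗ Y ⟶ X' ⊗ Y') (W : E) :
    X ⊗ Y ⊗ W ⟶ X' ⊗ Y' ⊗ W :=
  (α_ X Y W).inv ≫ f ▷ W ≫ (α_ X' Y' W).hom

theorem doubleWhisker_comp {X Y X' Y' X'' Y'' : E} (f : X ⊗ Y ⟶ X' ⊗ Y')
    (g : X' ⊗ Y' ⟶ X'' ⊗ Y'') (W : E) :
    doubleWhisker f W ≫ doubleWhisker g W = doubleWhisker (f ≫ g) W := by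
  simp [doubleWhisker]

theorem doubleWhisker_id (X Y W : E) : doubleWhisker (𝟙 (X ⊗ Y)) W = 𝟙 _ := by
  simp [doubleWhisker]

theorem doubleWhisker_comp_whiskerLeft {X Y X' Y' W W' : E} (f : X ⊗ Y ⟶ X' ⊗ Y') (g : W ⟶ W') :
    doubleWhisker f W ≫ X' ◁ Y' ◁ g = X ◁ Y ◁ g ≫ doubleWhisker f W' := by
  simp only [doubleWhisker, Category.assoc]
  rw [← associator_naturality_right, ← whisker_exchange_assoc,
    associator_inv_naturality_right_assoc]

theorem tripleWhisker_comp_whiskerLeft {X Y Z X' Y' Z' W W' : E}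
    (f : X ⊗ Y ⊗ Z ⟶ X' ⊗ Y' ⊗ Z') (g : W ⟶ W') :
    tripleWhisker f W ≫ X' ◁ Y' ◁ Z' ◁ g = X ◁ Y ◁ Z ◁ g ≫ tripleWhisker f W' := by
  simp only [tripleWhisker, Category.assoc]
  rw [← whiskerLeft_comp, ← associator_naturality_right, whiskerLeft_comp,
    ← associator_naturality_right_assoc, ← whisker_exchange_assoc,
    ← associator_inv_naturality_right_assoc, ← whiskerLeft_comp_assoc,
    ← associator_inv_naturality_right, whiskerLeft_comp_assoc]

/-- The operators on a family of objects: they assign to each index a morphism from the object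
with this index to some object of the family. -/
def Operator {I : Type*} (o : I → E) : Type _ := ∀ i, Σ j, (o i ⟶ o j)

namespace Operator

variable {I : Type*} {o : I → E}

/-- Composition of operators in diagrammatic order. -/
instance : Monoid (Operator o) where
  mul θ η := fun i => match θ i with
    | ⟨j, f⟩ => match η j with
      | ⟨k, g⟩ => ⟨k, f ≫ g⟩
  one := fun i => ⟨i, 𝟙 _⟩
  mul_assoc _ _ _ := funext fun _ => Sigma.ext rfl (heq_of_eq (Category.assoc _ _ _))
  one_mul _ := funext fun _ => Sigma.ext rfl (heq_of_eq (Category.id_comp _))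
  mul_one _ := funext fun _ => Sigma.ext rfl (heq_of_eq (Category.comp_id _))

end Operator

variable {ι : Type*} {I : Type*}

/-- Tensoring a family of objects on the left with the objects of another family. -/
def consObj (X : ι → E) (o : I → E) : ι × I → E := fun p => X p.1 ⊗ o p.2

variable {X : ι → E} {o : I → E}

namespace Operator

variable (X) in
/-- The operator on the remaining factors. -/
def shift : Operator o →* Operator (consObj X o) where
  toFun θ := fun
    | ⟨a, i⟩ => match θ i with
      | ⟨j, f⟩ => ⟨(a, j), X a ◁ f⟩
  map_one' := funext fun _ => Sigma.ext rfl (heq_of_eq (whiskerLeft_id _ _))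
  map_mul' _ _ := funext fun _ => Sigma.ext rfl (heq_of_eq (whiskerLeft_comp _ _ _))

variable (h : ∀ a, HalfBraiding (X a))

variable (o) in
/-- The operator exchanging the first two factors. -/
def crossing : Operator (consObj X (consObj X o)) :=
  fun
    | ⟨a, b, i⟩ => ⟨(b, a, i), doubleWhisker ((h a).β (X b)).hom (o i)⟩

variable (o) in
/-- The operator applying a family of morphisms to the first three factors. -/
def coupon (N : ∀ a b c, X a ⊗ X b ⊗ X c ⟶ X a ⊗ X b ⊗ X c) :
    Operator (consObj X (consObj X (consObj X o))) :=
  fun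
    | ⟨a, b, c, i⟩ => ⟨(a, b, c, i), tripleWhisker (N a b c) (o i)⟩

theorem crossing_mul_self
    (hs : ∀ a b, ((h a).β (X b)).hom ≫ ((h b).β (X a)).hom = 𝟙 _) :
    crossing o h * crossing o h = 1 := by
  refine funext fun p => Sigma.ext rfl (heq_of_eq ?_)
  exact (doubleWhisker_comp _ _ _).trans ((congrArg (doubleWhisker · _) (hs _ _)).trans
    (doubleWhisker_id _ _ _))

theorem crossing_mul_shift_shift (θ : Operator o) :
    crossing o h * shift X (shift X θ) = shift X (shift X θ) * crossing o h := by
  refine funext fun p => Sigma.ext rfl (heq_of_eq ?_)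
  exact doubleWhisker_comp_whiskerLeft _ _

theorem coupon_mul_shift_shift_shift (N : ∀ a b c, X a ⊗ X b ⊗ X c ⟶ X a ⊗ X b ⊗ X c)
    (θ : Operator o) :
    coupon o N * shift X (shift X (shift X θ)) = shift X (shift X (shift X θ)) * coupon o N := by
  refine funext fun p => Sigma.ext rfl (heq_of_eq ?_)
  exact tripleWhisker_comp_whiskerLeft _ _

/-- This is naturality of the half-braiding of the first strand with respect to the crossing of the
other two, its values on twofold products being split by the hexagon. -/
theorem crossing_braid :
    crossing _ h * shift X (crossing o h) * crossing _ h =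
      shift X (crossing o h) * crossing _ h * shift X (crossing o h) := by
  refine funext fun p => Sigma.ext rfl (heq_of_eq ?_)
  obtain ⟨a, b, c, i⟩ := p
  change (doubleWhisker ((h a).β (X b)).hom (X c ⊗ o i) ≫
      X b ◁ doubleWhisker ((h a).β (X c)).hom (o i)) ≫
      doubleWhisker ((h b).β (X c)).hom (X a ⊗ o i) =
    ((X a ◁ doubleWhisker ((h b).β (X c)).hom (o i)) ≫
      doubleWhisker ((h a).β (X c)).hom (X b ⊗ o i)) ≫
      X c ◁ doubleWhisker ((h a).β (X b)).hom (o i)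
  have key := (h a).naturality ((h b).β (X c)).hom
  rw [(h a).monoidal, (h a).monoidal] at key
  -- Whisker with the remaining word and rebracket to the right; both ends then match up to
  -- associators.
  have key' := congrArg (fun f => X a ◁ (α_ _ _ _).inv ≫ (α_ _ _ _).inv ≫ f ▷ o i ≫
    (α_ _ _ _).hom ≫ (α_ _ _ _).hom) key
  simp only [doubleWhisker]
  refine Eq.trans ?_ (key'.symm.trans ?_)
  · monoidal
  · monoidal

/-- A strand passes over an arbitrary coupon because its half-braiding is natural with respect to
all morphisms. This makes the neighbouring translates of a coupon conjugate once crossings are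
involutions. -/
theorem shift_coupon_mul (N : ∀ a b c, X a ⊗ X b ⊗ X c ⟶ X a ⊗ X b ⊗ X c) :
    shift X (coupon o N) * (crossing _ h * shift X (crossing _ h) *
        shift X (shift X (crossing _ h))) =
      crossing _ h * shift X (crossing _ h) * shift X (shift X (crossing _ h)) * coupon _ N := by
  refine funext fun p => Sigma.ext rfl (heq_of_eq ?_)
  obtain ⟨x, a, b, c, i⟩ := p
  change X x ◁ tripleWhisker (N a b c) (o i) ≫ (doubleWhisker ((h x).β (X a)).hom _ ≫
      X a ◁ doubleWhisker ((h x).β (X b)).hom (X c ⊗ o i)) ≫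
      X a ◁ X b ◁ doubleWhisker ((h x).β (X c)).hom (o i) =
    ((doubleWhisker ((h x).β (X a)).hom _ ≫
      X a ◁ doubleWhisker ((h x).β (X b)).hom (X c ⊗ o i)) ≫
      X a ◁ X b ◁ doubleWhisker ((h x).β (X c)).hom (o i)) ≫
      tripleWhisker (N a b c) (X x ⊗ o i)
  have key := (h x).naturality (N a b c)
  rw [(h x).monoidal, (h x).monoidal] at key
  have key' := congrArg (fun f => X x ◁ X a ◁ (α_ _ _ _).inv ≫ X x ◁ (α_ _ _ _).inv ≫
    (α_ _ _ _).inv ≫ f ▷ o i ≫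
    (α_ _ _ _).hom ≫ (α_ _ _ _).hom ≫ X a ◁ (α_ _ _ _).hom) key
  simp only [doubleWhisker, tripleWhisker]
  refine Eq.trans ?_ (key'.trans ?_)
  · monoidal
  · monoidal

end Operator

end StrandCalculus

/-! ### The word problem on six strands -/

set_option linter.unusedSimpArgs false in
/-- An identity in the monoid generated by the simple transpositions of six strands and two
elements `N`, `Z` supported on the first three strands. -/
theorem six_strand_identity {G : Type*} [Monoid G]
    {t₁ t₂ t₃ t₄ t₅ N N₂ N₃ N₄ Z Z₂ Z₃ Z₄ g r : G}
    (s₁ : t₁ * t₁ = 1) (s₂ : t₂ * t₂ = 1) (s₃ : t₃ * t₃ = 1) (s₄ : t₄ * t₄ = 1)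
    (s₅ : t₅ * t₅ = 1)
    (c₁₃ : t₁ * t₃ = t₃ * t₁) (c₁₄ : t₁ * t₄ = t₄ * t₁) (c₁₅ : t₁ * t₅ = t₅ * t₁)
    (c₂₄ : t₂ * t₄ = t₄ * t₂) (c₂₅ : t₂ * t₅ = t₅ * t₂) (c₃₅ : t₃ * t₅ = t₅ * t₃)
    (b₁ : t₁ * t₂ * t₁ = t₂ * t₁ * t₂) (b₂ : t₂ * t₃ * t₂ = t₃ * t₂ * t₃)
    (b₃ : t₃ * t₄ * t₃ = t₄ * t₃ * t₄) (b₄ : t₄ * t₅ * t₄ = t₅ * t₄ * t₅)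
    (n₄ : N * t₄ = t₄ * N) (n₅ : N * t₅ = t₅ * N) (z₄ : Z * t₄ = t₄ * Z) (z₅ : Z * t₅ = t₅ * Z)
    (hN₂ : N₂ * (t₁ * t₂ * t₃) = t₁ * t₂ * t₃ * N) (hN₃ : N₃ * (t₂ * t₃ * t₄) = t₂ * t₃ * t₄ * N₂)
    (hN₄ : N₄ * (t₃ * t₄ * t₅) = t₃ * t₄ * t₅ * N₃)
    (hZ₂ : Z₂ * (t₁ * t₂ * t₃) = t₁ * t₂ * t₃ * Z) (hZ₃ : Z₃ * (t₂ * t₃ * t₄) = t₂ * t₃ * t₄ * Z₂)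
    (hZ₄ : Z₄ * (t₃ * t₄ * t₅) = t₃ * t₄ * t₅ * Z₃)
    (hg : g = t₁ * (t₂ * (t₁ * (t₃ * (t₄ * (t₅ * (t₄ * (t₂ * (t₃ * (t₂ * (t₁ * (t₄ *
        (t₂ * (t₃ * (t₂ * (t₄ * (t₅ * t₄)))))))))))))))))
    (hr : r = t₄ * (t₅ * t₄)) :
    Z * (t₁ * (t₂ * (t₁ * (t₃ * (t₄ * (t₅ * (t₄ * (N₄ * (t₂ * (t₃ * (t₂ * (N₂ *
        (t₁ * (t₄ * (t₂ * (t₃ * (t₂ * N₂))))))))))))))))) =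
        g * (Z₄ * ((t₃ * (N * t₃)) * ((t₂ * (t₄ * (t₃ * (N * (t₃ * (t₄ * t₂)))))) *
          ((t₅ * (t₄ * (N₂ * (t₄ * t₅)))) * r)))) ∧
      t₃ * (t₄ * (t₃ * (N₃ * (t₂ * (t₅ * (t₃ * (t₄ * (t₃ * (N₃ * (t₁ * (t₂ * (t₁ * (N *
        (t₃ * (Z₄ * (t₄ * (t₅ * t₄))))))))))))))))) =
        g * ((t₅ * (t₄ * (N₂ * (t₄ * t₅)))) * ((t₂ * (t₄ * (t₃ * (N * (t₃ * (t₄ * t₂)))))) *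
          ((t₃ * (N * t₃)) * (Z₄ * r)))) := by
  have k (x y : G) (h : x = y) (w : G) : x * w = y * w := by rw [h]
  -- Solves the sliding relations for the translated coupon, so that only `N`, `Z` and the `tᵢ`
  -- remain.
  have conj {a b c x y : G} (ha : a * a = 1) (hb : b * b = 1) (hc : c * c = 1)
      (hx : x * (a * b * c) = a * b * c * y) : x = a * b * c * y * c * b * a := by
    have h := k _ _ hx (c * b * a)
    simp only [mul_assoc] at h ⊢
    rw [← h, ← mul_assoc c c, hc, one_mul, ← mul_assoc b b, hb, one_mul, ha, mul_one]
  -- The commutations are used to move larger indices to the left, which can hide a subword `tᵢ tᵢ₊₁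
  -- tᵢ`. The rules `eᵢⱼ`, with left side `tᵢ ⋯ tⱼ tᵢ`, supply the braid moves lost in this way.
  have e₁₃ : t₁ * (t₂ * (t₃ * t₁)) = t₂ * (t₁ * (t₂ * t₃)) := by
    rw [← c₁₃]; simpa only [mul_assoc] using k _ _ b₁ t₃
  have e₂₄ : t₂ * (t₃ * (t₄ * t₂)) = t₃ * (t₂ * (t₃ * t₄)) := by
    rw [← c₂₄]; simpa only [mul_assoc] using k _ _ b₂ t₄
  have e₃₅ : t₃ * (t₄ * (t₅ * t₃)) = t₄ * (t₃ * (t₄ * t₅)) := by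
    rw [← c₃₅]; simpa only [mul_assoc] using k _ _ b₃ t₅
  have e₁₄ : t₁ * (t₂ * (t₃ * (t₄ * t₁))) = t₂ * (t₁ * (t₂ * (t₃ * t₄))) := by
    rw [← c₁₄]; simpa only [mul_assoc] using k _ _ e₁₃ t₄
  have e₂₅ : t₂ * (t₃ * (t₄ * (t₅ * t₂))) = t₃ * (t₂ * (t₃ * (t₄ * t₅))) := by
    rw [← c₂₅]; simpa only [mul_assoc] using k _ _ e₂₄ t₅
  have e₁₅ : t₁ * (t₂ * (t₃ * (t₄ * (t₅ * t₁)))) = t₂ * (t₁ * (t₂ * (t₃ * (t₄ * t₅)))) := by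
    rw [← c₁₅]; simpa only [mul_assoc] using k _ _ e₁₄ t₅
  rw [mul_assoc, mul_assoc] at b₁ b₂ b₃ b₄
  have s₁' := k _ _ s₁
  have s₂' := k _ _ s₂
  have s₃' := k _ _ s₃
  have s₄' := k _ _ s₄
  have s₅' := k _ _ s₅
  have c₁₃' := k _ _ c₁₃
  have c₁₄' := k _ _ c₁₄
  have c₁₅' := k _ _ c₁₅
  have c₂₄' := k _ _ c₂₄
  have c₂₅' := k _ _ c₂₅
  have c₃₅' := k _ _ c₃₅
  have b₁' := k _ _ b₁
  have b₂' := k _ _ b₂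
  have b₃' := k _ _ b₃
  have b₄' := k _ _ b₄
  have e₁₃' := k _ _ e₁₃
  have e₂₄' := k _ _ e₂₄
  have e₃₅' := k _ _ e₃₅
  have e₁₄' := k _ _ e₁₄
  have e₂₅' := k _ _ e₂₅
  have e₁₅' := k _ _ e₁₅
  have n₄' := k _ _ n₄
  have n₅' := k _ _ n₅
  have z₄' := k _ _ z₄
  have z₅' := k _ _ z₅
  simp only [mul_assoc, one_mul] at s₁' s₂' s₃' s₄' s₅' c₁₃' c₁₄' c₁₅' c₂₄' c₂₅' c₃₅'
  simp only [mul_assoc] at b₁' b₂' b₃' b₄' e₁₃' e₂₄' e₃₅' e₁₄' e₂₅' e₁₅' n₄' n₅' z₄' z₅'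
  rw [conj s₁ s₂ s₃ hN₂] at hN₃ ⊢
  rw [conj s₂ s₃ s₄ hN₃] at hN₄ ⊢
  rw [conj s₁ s₂ s₃ hZ₂] at hZ₃
  rw [conj s₂ s₃ s₄ hZ₃] at hZ₄
  rw [conj s₃ s₄ s₅ hN₄, conj s₃ s₄ s₅ hZ₄]
  rw [hg, hr]
  -- Both sides of each equation are rewritten to a common normal form, with `t₄` and `t₅` moved to
  -- the left of `N` and `Z`.
  constructor <;>
  simp only [mul_assoc, mul_one, s₁, s₂, s₃, s₄, s₅, c₁₃, c₁₄, c₁₅, c₂₄, c₂₅, c₃₅, b₁, b₂, b₃, b₄,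
    e₁₃, e₂₄, e₃₅, e₁₄, e₂₅, e₁₅, n₄, n₅, z₄, z₅, s₁', s₂', s₃', s₄', s₅', c₁₃', c₁₄', c₁₅', c₂₄',
    c₂₅', c₃₅', b₁', b₂', b₃', b₄', e₁₃', e₂₄', e₃₅', e₁₄', e₂₅', e₁₅', n₄', n₅', z₄', z₅']

/-! ### Evaluating the monoid identity on `BBBCCC` -/

section StrandCalculus

open MonoidalCategory
variable {E : Type u} [Category.{v} E] [MonoidalCategory E]

theorem tripleWhisker_comp {X Y Z X' Y' Z' X'' Y'' Z'' : E} (f : X ⊗ Y ⊗ Z ⟶ X' ⊗ Y' ⊗ Z')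
    (g : X' ⊗ Y' ⊗ Z' ⟶ X'' ⊗ Y'' ⊗ Z'') (W : E) :
    tripleWhisker (f ≫ g) W = tripleWhisker f W ≫ tripleWhisker g W := by
  simp only [tripleWhisker]
  monoidal

theorem tripleWhisker_reversal {X Y Z : E} (tXY : X ⊗ Y ≅ Y ⊗ X) (tXZ : X ⊗ Z ≅ Z ⊗ X)
    (tYZ : Y ⊗ Z ≅ Z ⊗ Y) (W : E) :
    tripleWhisker (reversal tXY tXZ tYZ).hom W =
      doubleWhisker tXY.hom (Z ⊗ W) ≫ Y ◁ doubleWhisker tXZ.hom W ≫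
        doubleWhisker tYZ.hom (X ⊗ W) := by
  simp only [tripleWhisker, doubleWhisker, reversal, onTwo, Iso.trans_hom, Iso.symm_hom,
    whiskerRightIso_hom, whiskerLeftIso_hom]
  monoidal

instance {X Y X' Y' : E} (f : X ⊗ Y ⟶ X' ⊗ Y') [IsIso f] (W : E) : IsIso (doubleWhisker f W) := by
  unfold doubleWhisker; infer_instance

namespace Operator

variable {ι I : Type*} {X : ι → E} {o : I → E}

/-- Computes a product of operators on one word by following the index through the factors; an
identity of operators is thereby read as an identity of typed composites. -/
theorem mul_eval {E : Type u} [Category.{v} E] {I : Type*} {o : I → E} {θ η : Operator o}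
    {i j k : I} {f : o i ⟶ o j} {g : o j ⟶ o k}
    (h₁ : θ i = ⟨j, f⟩) (h₂ : η j = ⟨k, g⟩) : (θ * η) i = ⟨k, f ≫ g⟩ := by
  change (match θ i with
    | ⟨j, f⟩ => match η j with
      | ⟨k, g⟩ => ⟨k, f ≫ g⟩ : Σ j, (o i ⟶ o j)) = _
  rw [h₁]
  dsimp only
  rw [h₂]

theorem hom_eq_of_eval {E : Type u} [Category.{v} E] {I : Type*} {o : I → E} {θ η : Operator o}
    (h : θ = η) {i j : I} {f g : o i ⟶ o j}
    (h₁ : θ i = ⟨j, f⟩) (h₂ : η i = ⟨j, g⟩) : f = g := by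
  subst h
  exact eq_of_heq (Sigma.mk.inj (h₁.symm.trans h₂)).2

/-- The operator `θ` sends the object with index `i` isomorphically to that with index `j`. -/
def IsoSends (θ : Operator o) (i j : I) : Prop := ∃ f : o i ⟶ o j, IsIso f ∧ θ i = ⟨j, f⟩

theorem IsoSends.mul {E : Type u} [Category.{v} E] {I : Type*} {o : I → E} {θ η : Operator o}
    {i j k : I} (h₁ : IsoSends θ i j) (h₂ : IsoSends η j k) :
    IsoSends (θ * η) i k := by
  obtain ⟨f, _, hf⟩ := h₁
  obtain ⟨g, _, hg⟩ := h₂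
  exact ⟨f ≫ g, inferInstance, mul_eval hf hg⟩

theorem IsoSends.shift {θ : Operator o} {i j : I} (h : IsoSends θ i j) (a : ι) :
    IsoSends (shift X θ) (a, i) (a, j) := by
  obtain ⟨f, _, hf⟩ := h
  refine ⟨X a ◁ f, inferInstanceAs (IsIso (X a ◁ f : X a ⊗ o i ⟶ X a ⊗ o j)), ?_⟩
  change (match θ i with
    | ⟨j, f⟩ => ⟨(a, j), X a ◁ f⟩ : Σ j, (consObj X o (a, i) ⟶ consObj X o j)) = _
  rw [hf]

theorem IsoSends.crossing (h : ∀ a, HalfBraiding (X a)) (a b : ι) (i : I) :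
    IsoSends (crossing o h) (a, b, i) (b, a, i) :=
  ⟨doubleWhisker ((h a).β (X b)).hom (o i),
    inferInstanceAs (IsIso (doubleWhisker ((h a).β (X b)).hom (o i))), rfl⟩

end Operator

open Operator

/-- The two sides of the first equation are the values at `BBBCCC` of the two words in
`six_strand_identity`, whose common outer factors `g` and `r` take isomorphisms as values there. The
factor `W` provides a base object to the right of all strands, so the last strands need no separate
treatment. -/
theorem six_strand_equation {B C : E} (hB : HalfBraiding B) (hC : HalfBraiding C)
    (hBB : (hB.β B).hom ≫ (hB.β B).hom = 𝟙 _) (hBC : (hB.β C).hom ≫ (hC.β B).hom = 𝟙 _)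
    (hCB : (hC.β B).hom ≫ (hB.β C).hom = 𝟙 _) (hCC : (hC.β C).hom ≫ (hC.β C).hom = 𝟙 _)
    (N : C ⊗ C ⊗ B ⟶ C ⊗ C ⊗ B) (Z : B ⊗ B ⊗ B ⟶ B ⊗ B ⊗ B) (W : E)
    (M : B ⊗ C ⊗ C ⟶ C ⊗ C ⊗ B) (hM : M = (reversal (hB.β C) (hB.β C) (hC.β C)).hom ≫ N)
    (S : B ⊗ B ⊗ B ⟶ B ⊗ B ⊗ B) (hS : S = Z ≫ (reversal (hB.β B) (hB.β B) (hB.β B)).hom)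
    (l₁₂₄ l₁₃₅ l₂₃₆ : C ⊗ C ⊗ C ⊗ B ⊗ B ⊗ B ⊗ W ⟶ C ⊗ C ⊗ C ⊗ B ⊗ B ⊗ B ⊗ W)
    (h₁₂₄ : l₁₂₄ = C ◁ C ◁ doubleWhisker (hC.β B).hom (B ⊗ B ⊗ W) ≫
      tripleWhisker N (C ⊗ B ⊗ B ⊗ W) ≫ C ◁ C ◁ doubleWhisker (hB.β C).hom (B ⊗ B ⊗ W))
    (h₁₃₅ : l₁₃₅ = C ◁ doubleWhisker (hC.β C).hom (B ⊗ B ⊗ B ⊗ W) ≫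
      C ◁ C ◁ C ◁ doubleWhisker (hB.β B).hom (B ⊗ W) ≫
      C ◁ C ◁ doubleWhisker (hC.β B).hom (B ⊗ B ⊗ W) ≫
      tripleWhisker N (C ⊗ B ⊗ B ⊗ W) ≫ C ◁ C ◁ doubleWhisker (hB.β C).hom (B ⊗ B ⊗ W) ≫
      C ◁ C ◁ C ◁ doubleWhisker (hB.β B).hom (B ⊗ W) ≫
      C ◁ doubleWhisker (hC.β C).hom (B ⊗ B ⊗ B ⊗ W))
    (h₂₃₆ : l₂₃₆ = C ◁ C ◁ C ◁ B ◁ doubleWhisker (hB.β B).hom W ≫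
      C ◁ C ◁ C ◁ doubleWhisker (hB.β B).hom (B ⊗ W) ≫
      C ◁ tripleWhisker N (B ⊗ B ⊗ W) ≫
      C ◁ C ◁ C ◁ doubleWhisker (hB.β B).hom (B ⊗ W) ≫
      C ◁ C ◁ C ◁ B ◁ doubleWhisker (hB.β B).hom W) :
    tripleWhisker S (C ⊗ C ⊗ C ⊗ W) ≫
        B ◁ B ◁ doubleWhisker (hB.β C).hom (C ⊗ C ⊗ W) ≫
        B ◁ B ◁ C ◁ tripleWhisker M W ≫
        B ◁ tripleWhisker M (C ⊗ B ⊗ W) ≫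
        doubleWhisker (hB.β C).hom (C ⊗ B ⊗ C ⊗ B ⊗ W) ≫
        C ◁ B ◁ C ◁ doubleWhisker (hB.β C).hom (B ⊗ W) ≫
        C ◁ tripleWhisker M (B ⊗ B ⊗ W) =
      B ◁ B ◁ tripleWhisker M (C ⊗ W) ≫
        B ◁ doubleWhisker (hB.β C).hom (C ⊗ B ⊗ C ⊗ W) ≫
        B ◁ C ◁ B ◁ C ◁ doubleWhisker (hB.β C).hom W ≫
        B ◁ C ◁ tripleWhisker M (B ⊗ W) ≫
        tripleWhisker M (C ⊗ B ⊗ B ⊗ W) ≫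
        C ◁ C ◁ doubleWhisker (hB.β C).hom (B ⊗ B ⊗ W) ≫
        C ◁ C ◁ C ◁ tripleWhisker S W ↔
    (C ◁ C ◁ C ◁ tripleWhisker Z W) ≫ l₁₂₄ ≫ l₁₃₅ ≫ l₂₃₆ =
      l₂₃₆ ≫ l₁₃₅ ≫ l₁₂₄ ≫ C ◁ C ◁ C ◁ tripleWhisker Z W := by
  -- The label `true` stands for `B` and `false` for `C`.
  let X : Bool → E := fun b => match b with | true => B | false => C
  let h : ∀ b, HalfBraiding (X b) := fun b => match b with | true => hB | false => hC
  have hs (a b : Bool) : ((h a).β (X b)).hom ≫ ((h b).β (X a)).hom = 𝟙 _ :=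
    match a, b with
    | true, true => hBB
    | true, false => hBC
    | false, true => hCB
    | false, false => hCC
  -- A coupon must act on every word. It is the identity away from the type `CCB` (for `N`) or `BBB`
  -- (for `Z`); those values do not occur in the evaluation below.
  let fN : ∀ a b c, X a ⊗ X b ⊗ X c ⟶ X a ⊗ X b ⊗ X c := fun a b c =>
    match a, b, c with
    | false, false, true => N
    | false, false, false => 𝟙 _
    | false, true, _ => 𝟙 _
    | true, _, _ => 𝟙 _
  let fZ : ∀ a b c, X a ⊗ X b ⊗ X c ⟶ X a ⊗ X b ⊗ X c := fun a b c =>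
    match a, b, c with
    | true, true, true => Z
    | true, true, false => 𝟙 _
    | true, false, _ => 𝟙 _
    | false, _, _ => 𝟙 _
  let o : Unit → E := fun _ => W
  have hx {I : Type} (o : I → E) : crossing o h * crossing o h = 1 := crossing_mul_self h hs
  have sh {I : Type} {o : I → E} {θ η : Operator o} (e : θ = η) : shift X θ = shift X η := by rw [e]
  let t₁ := crossing (consObj X (consObj X (consObj X (consObj X o)))) h
  let t₂ := shift X (crossing (consObj X (consObj X (consObj X o))) h)
  let t₃ := shift X (shift X (crossing (consObj X (consObj X o)) h))
  let t₄ := shift X (shift X (shift X (crossing (consObj X o) h)))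
  let t₅ := shift X (shift X (shift X (shift X (crossing o h))))
  -- The crossings of the first composite in their order, with the coupons deleted, followed by `r`;
  -- as `r` is an involution, `g * r` has the permutation of that composite.
  let g : Operator (consObj X (consObj X (consObj X (consObj X (consObj X (consObj X o)))))) :=
    t₁ * (t₂ * (t₁ * (t₃ * (t₄ * (t₅ * (t₄ * (t₂ * (t₃ * (t₂ * (t₁ * (t₄ *
        (t₂ * (t₃ * (t₂ * (t₄ * (t₅ * t₄))))))))))))))))
  let r := t₄ * (t₅ * t₄)
  let N₁ := coupon (consObj X (consObj X (consObj X o))) fN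
  let N₂ := shift X (coupon (consObj X (consObj X o)) fN)
  let N₃ := shift X (shift X (coupon (consObj X o) fN))
  let N₄ := shift X (shift X (shift X (coupon o fN)))
  let Z₁ := coupon (consObj X (consObj X (consObj X o))) fZ
  let Z₂ := shift X (coupon (consObj X (consObj X o)) fZ)
  let Z₃ := shift X (shift X (coupon (consObj X o) fZ))
  let Z₄ := shift X (shift X (shift X (coupon o fZ)))
  obtain ⟨h₁, h₂⟩ := six_strand_identity
    (t₁ := t₁) (t₂ := t₂) (t₃ := t₃) (t₄ := t₄) (t₅ := t₅) (g := g) (r := r)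
    (N := N₁) (N₂ := N₂) (N₃ := N₃) (N₄ := N₄) (Z := Z₁) (Z₂ := Z₂) (Z₃ := Z₃) (Z₄ := Z₄)
    (hx _) (by rw [← map_mul, hx, map_one])
    (by simp only [t₃, ← map_mul, hx, map_one])
    (by simp only [t₄, ← map_mul, hx, map_one])
    (by simp only [t₅, ← map_mul, hx, map_one])
    (crossing_mul_shift_shift _ _) (crossing_mul_shift_shift _ _) (crossing_mul_shift_shift _ _)
    (by simpa only [map_mul] using sh (crossing_mul_shift_shift h (crossing (consObj X o) h)))
    (by simpa only [map_mul] using sh (crossing_mul_shift_shift h (shift X (crossing o h))))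
    (by simpa only [map_mul] using sh (sh (crossing_mul_shift_shift h (crossing o h))))
    (crossing_braid _)
    (by simpa only [map_mul] using sh (crossing_braid (o := consObj X (consObj X o)) h))
    (by simpa only [map_mul] using sh (sh (crossing_braid (o := consObj X o) h)))
    (by simpa only [map_mul] using sh (sh (sh (crossing_braid (o := o) h))))
    (coupon_mul_shift_shift_shift _ _) (coupon_mul_shift_shift_shift _ _)
    (coupon_mul_shift_shift_shift _ _) (coupon_mul_shift_shift_shift _ _)
    (shift_coupon_mul _ _)
    (by simpa only [map_mul] using sh (shift_coupon_mul (o := consObj X o) h fN))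
    (by simpa only [map_mul] using sh (sh (shift_coupon_mul (o := o) h fN)))
    (shift_coupon_mul _ _)
    (by simpa only [map_mul] using sh (shift_coupon_mul (o := consObj X o) h fZ))
    (by simpa only [map_mul] using sh (sh (shift_coupon_mul (o := o) h fZ))) rfl rfl
  let w : Bool × Bool × Bool × Bool × Bool × Bool × Unit :=
    (true, true, true, false, false, false, ())
  let v : Bool × Bool × Bool × Bool × Bool × Bool × Unit :=
    (false, false, false, true, true, true, ())
  have e₁ (a b c d e f : Bool) : t₁ (a, b, c, d, e, f, ()) =
    ⟨(b, a, c, d, e, f, ()), doubleWhisker ((h a).β (X b)).hom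
      (X c ⊗ X d ⊗ X e ⊗ X f ⊗ W)⟩ := rfl
  have e₂ (a b c d e f : Bool) : t₂ (a, b, c, d, e, f, ()) =
    ⟨(a, c, b, d, e, f, ()), X a ◁ doubleWhisker ((h b).β (X c)).hom (X d ⊗ X e ⊗ X f ⊗ W)⟩ := rfl
  have e₃ (a b c d e f : Bool) : t₃ (a, b, c, d, e, f, ()) =
    ⟨(a, b, d, c, e, f, ()), X a ◁ X b ◁ doubleWhisker ((h c).β (X d)).hom
      (X e ⊗ X f ⊗ W)⟩ := rfl
  have e₄ (a b c d e f : Bool) : t₄ (a, b, c, d, e, f, ()) =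
    ⟨(a, b, c, e, d, f, ()), X a ◁ X b ◁ X c ◁ doubleWhisker ((h d).β (X e)).hom
      (X f ⊗ W)⟩ := rfl
  have e₅ (a b c d e f : Bool) : t₅ (a, b, c, d, e, f, ()) =
    ⟨(a, b, c, d, f, e, ()), X a ◁ X b ◁ X c ◁ X d ◁ doubleWhisker ((h e).β (X f)).hom W⟩ := rfl
  have i₁ (a b c d e f : Bool) : IsoSends t₁ (a, b, c, d, e, f, ()) (b, a, c, d, e, f, ()) :=
    .crossing h _ _ _
  have i₂ (a b c d e f : Bool) : IsoSends t₂ (a, b, c, d, e, f, ()) (a, c, b, d, e, f, ()) :=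
    (IsoSends.crossing h _ _ _).shift _
  have i₃ (a b c d e f : Bool) : IsoSends t₃ (a, b, c, d, e, f, ()) (a, b, d, c, e, f, ()) :=
    ((IsoSends.crossing h _ _ _).shift _).shift _
  have i₄ (a b c d e f : Bool) : IsoSends t₄ (a, b, c, d, e, f, ()) (a, b, c, e, d, f, ()) :=
    (((IsoSends.crossing h _ _ _).shift _).shift _).shift _
  have i₅ (a b c d e f : Bool) : IsoSends t₅ (a, b, c, d, e, f, ()) (a, b, c, d, f, e, ()) :=
    ((((IsoSends.crossing h _ _ _).shift _).shift _).shift _).shift _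
  have hr : IsoSends r v v :=
    (i₄ _ _ _ _ _ _).mul <| (i₅ _ _ _ _ _ _).mul <| i₄ _ _ _ _ _ _
  have hg : IsoSends g w v :=
    (i₁ _ _ _ _ _ _).mul <| (i₂ _ _ _ _ _ _).mul <| (i₁ _ _ _ _ _ _).mul <|
    (i₃ _ _ _ _ _ _).mul <| (i₄ _ _ _ _ _ _).mul <| (i₅ _ _ _ _ _ _).mul <|
    (i₄ _ _ _ _ _ _).mul <| (i₂ _ _ _ _ _ _).mul <| (i₃ _ _ _ _ _ _).mul <|
    (i₂ _ _ _ _ _ _).mul <| (i₁ _ _ _ _ _ _).mul <| (i₄ _ _ _ _ _ _).mul <|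
    (i₂ _ _ _ _ _ _).mul <| (i₃ _ _ _ _ _ _).mul <| (i₂ _ _ _ _ _ _).mul hr
  obtain ⟨r₀, hr₁, hr₂⟩ : ∃ f : C ⊗ C ⊗ C ⊗ B ⊗ B ⊗ B ⊗ W ⟶ C ⊗ C ⊗ C ⊗ B ⊗ B ⊗ B ⊗ W,
    IsIso f ∧ r v = ⟨v, f⟩ := hr
  obtain ⟨g₀, hg₁, hg₂⟩ : ∃ f : B ⊗ B ⊗ B ⊗ C ⊗ C ⊗ C ⊗ W ⟶ C ⊗ C ⊗ C ⊗ B ⊗ B ⊗ B ⊗ W,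
    IsIso f ∧ g w = ⟨v, f⟩ := hg
  have hN₁ (d e f : Bool) : N₁ (false, false, true, d, e, f, ()) =
    ⟨(false, false, true, d, e, f, ()), tripleWhisker N (X d ⊗ X e ⊗ X f ⊗ W)⟩ := rfl
  have hN₂ (a e f : Bool) : N₂ (a, false, false, true, e, f, ()) =
    ⟨(a, false, false, true, e, f, ()), X a ◁ tripleWhisker N (X e ⊗ X f ⊗ W)⟩ := rfl
  have hN₃ (a b f : Bool) : N₃ (a, b, false, false, true, f, ()) =
    ⟨(a, b, false, false, true, f, ()), X a ◁ X b ◁ tripleWhisker N (X f ⊗ W)⟩ := rfl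
  have hN₄ (a b c : Bool) : N₄ (a, b, c, false, false, true, ()) =
    ⟨(a, b, c, false, false, true, ()), X a ◁ X b ◁ X c ◁ tripleWhisker N W⟩ := rfl
  have hZ₁ (d e f : Bool) : Z₁ (true, true, true, d, e, f, ()) =
    ⟨(true, true, true, d, e, f, ()), tripleWhisker Z (X d ⊗ X e ⊗ X f ⊗ W)⟩ := rfl
  have hZ₄ (a b c : Bool) : Z₄ (a, b, c, true, true, true, ()) =
    ⟨(a, b, c, true, true, true, ()), X a ◁ X b ◁ X c ◁ tripleWhisker Z W⟩ := rfl
  -- From here on only the recorded values are needed; hiding the definitions keeps unification from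
  -- unfolding them.
  clear_value t₁ t₂ t₃ t₄ t₅ N₁ N₂ N₃ N₄ Z₁ Z₂ Z₃ Z₄ g r
  rw [hM, hS]
  simp only [tripleWhisker_comp, tripleWhisker_reversal, whiskerLeft_comp, Category.assoc]
  -- Each composite is factored through `g₀` and `r₀`, which are isomorphisms and cancel in the last
  -- step.
  refine (Eq.congr (y₁ := g₀ ≫ (C ◁ C ◁ C ◁ tripleWhisker Z W) ≫ l₁₂₄ ≫ l₁₃₅ ≫ l₂₃₆ ≫ r₀)
    (y₂ := g₀ ≫ l₂₃₆ ≫ l₁₃₅ ≫ l₁₂₄ ≫ (C ◁ C ◁ C ◁ tripleWhisker Z W) ≫ r₀) ?_ ?_).trans ?_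
  · rw [h₁₂₄, h₁₃₅, h₂₃₆]
    refine hom_eq_of_eval (i := w) (j := v) h₁ ?_ ?_
    · refine mul_eval (hZ₁ _ _ _) <| mul_eval (e₁ _ _ _ _ _ _) <| mul_eval (e₂ _ _ _ _ _ _) <|
        mul_eval (e₁ _ _ _ _ _ _) <| mul_eval (e₃ _ _ _ _ _ _) <| mul_eval (e₄ _ _ _ _ _ _) <|
        mul_eval (e₅ _ _ _ _ _ _) <| mul_eval (e₄ _ _ _ _ _ _) <| mul_eval (hN₄ _ _ _) <|
        mul_eval (e₂ _ _ _ _ _ _) <| mul_eval (e₃ _ _ _ _ _ _) <| mul_eval (e₂ _ _ _ _ _ _) <|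
        mul_eval (hN₂ _ _ _) <| mul_eval (e₁ _ _ _ _ _ _) <| mul_eval (e₄ _ _ _ _ _ _) <|
        mul_eval (e₂ _ _ _ _ _ _) <| mul_eval (e₃ _ _ _ _ _ _) <| mul_eval (e₂ _ _ _ _ _ _) <|
        hN₂ _ _ _
    · refine mul_eval hg₂ <|
        mul_eval (hZ₄ _ _ _) <|
        mul_eval (mul_eval (e₃ _ _ _ _ _ _) <| mul_eval (hN₁ _ _ _) <| e₃ _ _ _ _ _ _) <|
        mul_eval (mul_eval (e₂ _ _ _ _ _ _) <| mul_eval (e₄ _ _ _ _ _ _) <| mul_eval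
            (e₃ _ _ _ _ _ _) <|
          mul_eval (hN₁ _ _ _) <| mul_eval (e₃ _ _ _ _ _ _) <| mul_eval (e₄ _ _ _ _ _ _) <|
          e₂ _ _ _ _ _ _) <|
        mul_eval (mul_eval (e₅ _ _ _ _ _ _) <| mul_eval (e₄ _ _ _ _ _ _) <| mul_eval (hN₂ _ _ _) <|
          mul_eval (e₄ _ _ _ _ _ _) <| e₅ _ _ _ _ _ _) <|
        hr₂
  · rw [h₁₂₄, h₁₃₅, h₂₃₆]
    refine hom_eq_of_eval (i := w) (j := v) h₂ ?_ ?_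
    · refine mul_eval (e₃ _ _ _ _ _ _) <| mul_eval (e₄ _ _ _ _ _ _) <| mul_eval (e₃ _ _ _ _ _ _) <|
        mul_eval (hN₃ _ _ _) <| mul_eval (e₂ _ _ _ _ _ _) <| mul_eval (e₅ _ _ _ _ _ _) <|
        mul_eval (e₃ _ _ _ _ _ _) <| mul_eval (e₄ _ _ _ _ _ _) <| mul_eval (e₃ _ _ _ _ _ _) <|
        mul_eval (hN₃ _ _ _) <| mul_eval (e₁ _ _ _ _ _ _) <| mul_eval (e₂ _ _ _ _ _ _) <|
        mul_eval (e₁ _ _ _ _ _ _) <| mul_eval (hN₁ _ _ _) <| mul_eval (e₃ _ _ _ _ _ _) <|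
        mul_eval (hZ₄ _ _ _) <| mul_eval (e₄ _ _ _ _ _ _) <| mul_eval (e₅ _ _ _ _ _ _) <|
        e₄ _ _ _ _ _ _
    · refine mul_eval hg₂ <|
        mul_eval (mul_eval (e₅ _ _ _ _ _ _) <| mul_eval (e₄ _ _ _ _ _ _) <| mul_eval (hN₂ _ _ _) <|
          mul_eval (e₄ _ _ _ _ _ _) <| e₅ _ _ _ _ _ _) <|
        mul_eval (mul_eval (e₂ _ _ _ _ _ _) <| mul_eval (e₄ _ _ _ _ _ _) <| mul_eval
            (e₃ _ _ _ _ _ _) <|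
          mul_eval (hN₁ _ _ _) <| mul_eval (e₃ _ _ _ _ _ _) <| mul_eval (e₄ _ _ _ _ _ _) <|
          e₂ _ _ _ _ _ _) <|
        mul_eval (mul_eval (e₃ _ _ _ _ _ _) <| mul_eval (hN₁ _ _ _) <| e₃ _ _ _ _ _ _) <|
        mul_eval (hZ₄ _ _ _) <|
        hr₂
  · rw [cancel_epi]
    simp only [← Category.assoc, cancel_mono]

end StrandCalculus

/-! ### Pseudo-naturality cells at composites -/

section General

open Bicategory
open scoped CategoryTheory.Prod
variable {𝒞 : Type u₁} [Bicategory.{w₁, v₁} 𝒞]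

theorem lt_mapComp_hom (T : TensorProduct 𝒞) (X : 𝒞) {Y Y' Y'' : 𝒞} (f : Y ⟶ Y') (g : Y' ⟶ Y'') :
    ((lt T X).mapComp f g).hom =
      T.map₂ (a := (X, Y)) (b := (X, Y'')) ((ρ_ (𝟙 X)).inv ×ₘ 𝟙 (f ≫ g)) ≫ (T.mapComp (𝟙 X ×ₘ f)
        (𝟙 X ×ₘ g)).hom :=
  rfl

/-- The iterated constraint of `X ⊗ (Y ⊗ -)` is that of `tensor₃` at identities in the first two
arguments, up to the unitors replacing `𝟙` by `𝟙 ≫ 𝟙`. This puts it in the form required by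
pseudo-naturality of `β`. -/
theorem lt_mapComp_lt (T : TensorProduct 𝒞) (X Y : 𝒞) {Z Z' Z'' : 𝒞} (f : Z ⟶ Z') (g : Z' ⟶ Z'') :
    (lt T X).map₂ ((lt T Y).mapComp f g).hom ≫
        ((lt T X).mapComp ((lt T Y).map f) ((lt T Y).map g)).hom =
      (tensor₃ T).map₂ (a := (X, Y, Z)) (b := (X, Y, Z''))
          ((ρ_ (𝟙 X)).inv ×ₘ ((ρ_ (𝟙 Y)).inv ×ₘ 𝟙 (f ≫ g))) ≫
        ((tensor₃ T).mapComp (𝟙 X ×ₘ (𝟙 Y ×ₘ f)) (𝟙 X ×ₘ (𝟙 Y ×ₘ g))).hom := by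
  have key : (lt T X).map₂ ((lt T Y).mapComp f g).hom ≫
        T.map₂ (a := (X, _)) (b := (X, _)) ((ρ_ (𝟙 X)).inv ×ₘ 𝟙 _) =
      (tensor₃ T).map₂ (a := (X, Y, Z)) (b := (X, Y, Z''))
          ((ρ_ (𝟙 X)).inv ×ₘ ((ρ_ (𝟙 Y)).inv ×ₘ 𝟙 (f ≫ g))) ≫
        T.map₂ (a := (X, _)) (b := (X, _))
          (𝟙 (𝟙 X ≫ 𝟙 X) ×ₘ (T.mapComp (𝟙 Y ×ₘ f) (𝟙 Y ×ₘ g)).hom) :=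
    (T.map₂_comp _ _).symm.trans <| (congrArg T.map₂ (Prod.ext
      ((Category.id_comp _).trans (Category.comp_id _).symm) (Category.comp_id _))).trans
      (T.map₂_comp _ _)
  exact (Category.assoc _ _ _).symm.trans ((congrArg (· ≫ _) key).trans (Category.assoc _ _ _))

theorem tensor₃'_mapComp_hom (T : TensorProduct 𝒞) {X Y Z : 𝒞 × 𝒞 × 𝒞} (f : X ⟶ Y) (g : Y ⟶ Z) :
    ((tensor₃' T).mapComp f g).hom =
      ((tensor₃ T).mapComp ((swapFst 𝒞).map f) ((swapFst 𝒞).map g)).hom :=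
  (congrArg (· ≫ _) ((tensor₃ T).map₂_id _)).trans (Category.id_comp _)

/-- Combines naturality in 2-cells (for the unitor part `p`) with the axiom at composites (for the
constraint `q`). -/
theorem comp_whiskerLeft_eq {a b c d : 𝒞} {x : a ⟶ b} {y : c ⟶ d} {f₁ f₂ f₃ : a ⟶ c}
    {g₁ g₂ g₃ : b ⟶ d} {p : f₁ ⟶ f₂} {q l : _} {p' : g₁ ⟶ g₂} {q' l' : _}
    {n₁ : f₁ ≫ y ⟶ x ≫ g₁} {n₂ : f₂ ≫ y ⟶ x ≫ g₂} {r : f₃ ≫ y ⟶ x ≫ g₃}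
    (hl : l = p ≫ q) (hl' : l' = p' ≫ q')
    (h₁ : p ▷ y ≫ n₂ = n₁ ≫ x ◁ p') (h₂ : n₂ ≫ x ◁ q' = q ▷ y ≫ r) :
    n₁ ≫ x ◁ l' = l ▷ y ≫ r := by
  rw [hl, hl', Bicategory.whiskerLeft_comp, Bicategory.comp_whiskerRight, ← Category.assoc, ← h₁,
    Category.assoc, h₂, Category.assoc]

variable (S : WeakBData 𝒞)

theorem WeakBData.βnat_comp (X Y : 𝒞) {Z Z' Z'' : 𝒞} (f : Z ⟶ Z') (g : Z' ⟶ Z'') :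
    (S.βnat (𝟙 X) (𝟙 Y) (f ≫ g)).hom ≫ S.β X Y Z ◁
        ((lt S.tensor Y).map₂ ((lt S.tensor X).mapComp f g).hom ≫
          ((lt S.tensor Y).mapComp ((lt S.tensor X).map f) ((lt S.tensor X).map g)).hom) =
      ((lt S.tensor X).map₂ ((lt S.tensor Y).mapComp f g).hom ≫
          ((lt S.tensor X).mapComp ((lt S.tensor Y).map f) ((lt S.tensor Y).map g)).hom) ▷
        S.β X Y Z'' ≫ (α_ _ _ _).hom ≫
        S.l X (S.l Y f) ◁ (S.βnat (𝟙 X) (𝟙 Y) g).hom ≫ (α_ _ _ _).inv ≫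
        (S.βnat (𝟙 X) (𝟙 Y) f).hom ▷ S.l Y (S.l X g) ≫ (α_ _ _ _).hom := by
  exact comp_whiskerLeft_eq (lt_mapComp_lt _ _ _ _ _) (lt_mapComp_lt _ _ _ _ _)
    (S.braid.naturality_naturality (a := (X, Y, Z)) (b := (X, Y, Z''))
      ((ρ_ (𝟙 X)).inv ×ₘ ((ρ_ (𝟙 Y)).inv ×ₘ 𝟙 (f ≫ g))))
    ((congrArg (fun z => (S.βnat (𝟙 X ≫ 𝟙 X) (𝟙 Y ≫ 𝟙 Y) (f ≫ g)).hom ≫ S.β X Y Z ◁ z)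
        (tensor₃'_mapComp_hom S.tensor (X := (X, Y, Z)) (Y := (X, Y, Z')) (Z := (X, Y, Z''))
          (𝟙 X ×ₘ (𝟙 Y ×ₘ f)) (𝟙 X ×ₘ (𝟙 Y ×ₘ g))).symm).trans
      (S.braid.naturality_comp (a := (X, Y, Z)) (b := (X, Y, Z')) (c := (X, Y, Z''))
        (𝟙 X ×ₘ (𝟙 Y ×ₘ f)) (𝟙 X ×ₘ (𝟙 Y ×ₘ g))))

/-- The correction by `mapId` in `nat₂` is an identity for the identity pseudofunctor. -/
theorem Comparison.nat₂_hom (C : Comparison S S (Pseudofunctor.id 𝒞)) (X : 𝒞) {Y Y' : 𝒞}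
    (f : Y ⟶ Y') :
    (C.nat₂ X f).hom = (C.nat (𝟙 X) f).hom := by
  exact (congrArg (_ ≫ _ ◁ ·) (S.tensor.map₂_id _)).trans
    ((congrArg (_ ≫ ·) (Bicategory.whiskerLeft_id _ _)).trans (Category.comp_id _))

theorem Comparison.nat_comp (C : Comparison S S (Pseudofunctor.id 𝒞)) (X : 𝒞) {Y Y' Y'' : 𝒞}
    (f : Y ⟶ Y') (g : Y' ⟶ Y'') :
    (C.nat (𝟙 X) (f ≫ g)).hom ≫ C.at₂ X Y ◁ ((lt S.tensor X).mapComp f g).hom =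
      ((lt S.tensor X).mapComp f g).hom ▷ C.at₂ X Y'' ≫ (α_ _ _ _).hom ≫
        S.l X f ◁ (C.nat (𝟙 X) g).hom ≫ (α_ _ _ _).inv ≫
        (C.nat (𝟙 X) f).hom ▷ S.l X g ≫ (α_ _ _ _).hom := by
  have h₁ := C.naturality_naturality (a := (X, Y)) (b := (X, Y''))
    ((ρ_ (𝟙 X)).inv ×ₘ 𝟙 (f ≫ g))
  have h₂ := C.naturality_comp (a := (X, Y)) (b := (X, Y')) (c := (X, Y''))
    (𝟙 X ×ₘ f) (𝟙 X ×ₘ g)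
  have h₃ : ((S.tensor.comp (Pseudofunctor.id 𝒞)).mapComp (a := (X, Y)) (b := (X, Y'))
      (c := (X, Y'')) (𝟙 X ×ₘ f) (𝟙 X ×ₘ g)).hom =
      (S.tensor.mapComp (a := (X, Y)) (b := (X, Y'))
      (c := (X, Y'')) (𝟙 X ×ₘ f) (𝟙 X ×ₘ g)).hom := Category.comp_id _
  have h₄ : (((prodMap (Pseudofunctor.id 𝒞) (Pseudofunctor.id 𝒞)).comp S.tensor).mapComp
      (a := (X, Y)) (b := (X, Y'))
      (c := (X, Y'')) (𝟙 X ×ₘ f) (𝟙 X ×ₘ g)).hom =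
      (S.tensor.mapComp (a := (X, Y)) (b := (X, Y'))
      (c := (X, Y'')) (𝟙 X ×ₘ f) (𝟙 X ×ₘ g)).hom := by
    exact (congrArg (· ≫ _) (S.tensor.map₂_id _)).trans (Category.id_comp _)
  refine comp_whiskerLeft_eq (lt_mapComp_hom _ _ _ _) (lt_mapComp_hom _ _ _ _) h₁ ?_
  exact (congrArg (_ ≫ _ ◁ ·) h₄.symm).trans (h₂.trans (congrArg (· ▷ _ ≫ _) h₃))

theorem Comparison.nat₂_comp (C : Comparison S S (Pseudofunctor.id 𝒞)) (X : 𝒞) {Y Y' Y'' : 𝒞}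
    (f : Y ⟶ Y') (g : Y' ⟶ Y'') :
    (C.nat₂ X (f ≫ g)).hom ≫ C.at₂ X Y ◁ ((lt S.tensor X).mapComp f g).hom =
      ((lt S.tensor X).mapComp f g).hom ▷ C.at₂ X Y'' ≫ (α_ _ _ _).hom ≫
        S.l X f ◁ (C.nat₂ X g).hom ≫ (α_ _ _ _).inv ≫
        (C.nat₂ X f).hom ▷ S.l X g ≫ (α_ _ _ _).hom := by
  rw [C.nat₂_hom S X f, C.nat₂_hom S X g, C.nat₂_hom S X (f ≫ g)]
  exact C.nat_comp S X f g

theorem Comparison.nat₂_naturality (C : Comparison S S (Pseudofunctor.id 𝒞)) (X : 𝒞) {Y Y' : 𝒞}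
    {f g : Y ⟶ Y'} (η : f ⟶ g) :
    (lt S.tensor X).map₂ η ▷ C.at₂ X Y' ≫ (C.nat₂ X g).hom =
      (C.nat₂ X f).hom ≫ C.at₂ X Y ◁ (lt S.tensor X).map₂ η := by
  rw [C.nat₂_hom S X f, C.nat₂_hom S X g]
  exact C.naturality_naturality (a := (X, Y)) (b := (X, Y')) (𝟙 (𝟙 X) ×ₘ η)

end General

/-! ### The half-braidings of `B` and `C` -/

section OneObject

open MonoidalCategory
variable {E : Type u} [Category.{v} E] [MonoidalCategory E]

/-- A half-braiding from cells `P X ⊗ B ≅ B ⊗ P X` for a monoidal functor `P` isomorphic to the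
identity. -/
def halfBraidingOfCells {B : E} (P : E → E) (m : ∀ {X Y : E}, (X ⟶ Y) → (P X ⟶ P Y))
    (e : ∀ X, P X ≅ X) (he : ∀ {X Y : E} (η : X ⟶ Y), m η ≫ (e Y).hom = (e X).hom ≫ η)
    (c : ∀ X Y, P (X ⊗ Y) ⟶ P X ⊗ P Y)
    (hc : ∀ X Y, c X Y ≫ ((e X).hom ⊗ₘ (e Y).hom) = (e (X ⊗ Y)).hom)
    (k : ∀ X, P X ⊗ B ≅ B ⊗ P X)
    (hk : ∀ {X Y : E} (η : X ⟶ Y), m η ▷ B ≫ (k Y).hom = (k X).hom ≫ B ◁ m η)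
    (hkc : ∀ X Y, (k (X ⊗ Y)).hom ≫ B ◁ c X Y = c X Y ▷ B ≫ (α_ _ _ _).hom ≫
      P X ◁ (k Y).hom ≫ (α_ _ _ _).inv ≫ (k X).hom ▷ P Y ≫ (α_ _ _ _).hom) :
    HalfBraiding B where
  β X := whiskerLeftIso B (e X).symm ≪≫ (k X).symm ≪≫ whiskerRightIso (e X) B
  naturality {X Y} f := by
    have hm : m f = (e X).hom ≫ f ≫ (e Y).inv := by
      rw [← Category.assoc, ← he, Category.assoc, Iso.hom_inv_id, Category.comp_id]
    have h := hk f
    rw [← Iso.inv_comp_eq, ← Category.assoc, ← Iso.eq_comp_inv, hm] at h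
    simp only [Iso.trans_hom, Iso.symm_hom, whiskerLeftIso_hom, whiskerRightIso_hom,
      Category.assoc]
    have h₂ := congrArg (fun g => B ◁ (e X).inv ≫ g ≫ (e Y).hom ▷ B) h
    simp only [MonoidalCategory.whiskerLeft_comp, comp_whiskerRight, Category.assoc,
      inv_hom_whiskerRight, Category.comp_id, whiskerLeft_inv_hom_assoc] at h₂
    exact h₂.symm
  monoidal X Y := by
    have hc' : c X Y = (e (X ⊗ Y)).hom ≫ ((e X).inv ⊗ₘ (e Y).inv) := by
      rw [← hc, Category.assoc]; simp
    -- The hexagon for the inverse cells, which is the direction in which `k` and `hkc` are given;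
    -- it is inverted at the end.
    have h : (e (X ⊗ Y)).inv ▷ B ≫ (k (X ⊗ Y)).hom ≫ B ◁ (e (X ⊗ Y)).hom =
        (α_ _ _ _).hom ≫ X ◁ ((e Y).inv ▷ B ≫ (k Y).hom ≫ B ◁ (e Y).hom) ≫ (α_ _ _ _).inv ≫
          ((e X).inv ▷ B ≫ (k X).hom ≫ B ◁ (e X).hom) ▷ Y ≫ (α_ _ _ _).hom := by
      -- Conjugating by `e X` replaces the outer factor `X` by `P X`, as it appears in `hkc`.
      have h₁ : X ◁ ((e Y).inv ▷ B ≫ (k Y).hom ≫ B ◁ (e Y).hom) =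
          (e X).inv ▷ _ ≫ P X ◁ ((e Y).inv ▷ B ≫ (k Y).hom ≫ B ◁ (e Y).hom) ≫ (e X).hom ▷ _ := by
        rw [whisker_exchange, inv_hom_whiskerRight_assoc]
      rw [← hc, MonoidalCategory.whiskerLeft_comp, reassoc_of% (hkc X Y), hc', h₁]
      have h₂ : P X ◁ B ◁ (e Y).hom ≫ (α_ _ _ _).inv ≫ (k X).hom ▷ Y =
          (α_ _ _ _).inv ≫ (k X).hom ▷ P Y ≫ (B ⊗ P X) ◁ (e Y).hom := by
        rw [associator_inv_naturality_right_assoc, whisker_exchange]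
      simp only [MonoidalCategory.whiskerLeft_comp, comp_whiskerRight, Category.assoc,
        inv_hom_whiskerRight_assoc, MonoidalCategory.tensorHom_def, whiskerRight_tensor_assoc,
        Iso.hom_inv_id_assoc]
      have h₃ {W : E} (f : (P X ⊗ B) ⊗ Y ⟶ W) :
          (e X).hom ▷ B ▷ Y ≫ (e X).inv ▷ B ▷ Y ≫ f = f := by
        simp [← comp_whiskerRight_assoc]
      rw [h₃, reassoc_of% h₂, whisker_exchange_assoc]
      monoidal
    let t (X : E) : B ⊗ X ≅ X ⊗ B :=
      whiskerLeftIso B (e X).symm ≪≫ (k X).symm ≪≫ whiskerRightIso (e X) B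
    exact (Iso.inv_eq_inv (t (X ⊗ Y)) ((α_ _ _ _).symm ≪≫ whiskerRightIso (t X) Y ≪≫ α_ _ _ _ ≪≫
      whiskerLeftIso X (t Y) ≪≫ (α_ _ _ _).symm)).1 (by simpa [t] using h)

variable (S : WeakBData (MonoidalSingleObj E)) (u : UnitIdentification S.tensor)

theorem lMap_ident₂ {X Y : E} (η : X ⟶ Y) :
    lMap S.tensor (lMap S.tensor η) ≫ (ident₂ S u Y).hom = (ident₂ S u X).hom ≫ η := by
  simp only [ident₂, Iso.trans_hom, Category.assoc]
  rw [← Category.assoc, u.naturality, Category.assoc, u.naturality]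

theorem lComp_ident₂ (X Y : E) :
    (lMap S.tensor (lComp S.tensor X Y).hom ≫ (lComp S.tensor _ _).hom) ≫
      ((ident₂ S u X).hom ⊗ₘ (ident₂ S u Y).hom) = (ident₂ S u (X ⊗ Y)).hom := by
  simp only [ident₂, Iso.trans_hom, Category.assoc, ← tensorHom_comp_tensorHom]
  rw [reassoc_of% u.comp, ← Category.assoc, u.naturality, Category.assoc, u.comp]

/-- The half-braiding of `B`. -/
def halfBraidingB : HalfBraiding (objB S) :=
  halfBraidingOfCells (fun X => lObj S.tensor (lObj S.tensor X))
    (fun η => lMap S.tensor (lMap S.tensor η)) (ident₂ S u) (lMap_ident₂ S u)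
    (fun X Y => lMap S.tensor (lComp S.tensor X Y).hom ≫ (lComp S.tensor _ _).hom)
    (lComp_ident₂ S u)
    (fun X => (S.b₃ (pt E) (pt E) (Z := pt E) (Z' := pt E) X).symm)
    (fun η => S.braid.naturality_naturality (a := (pt E, pt E, pt E)) (b := (pt E, pt E, pt E))
      (CategoryTheory.Prod.mkHom (𝟙 (𝟙_ E)) (CategoryTheory.Prod.mkHom (𝟙 (𝟙_ E)) η)))
    (fun X Y => S.βnat_comp (pt E) (pt E) (Z := pt E) (Z' := pt E) (Z'' := pt E) X Y)

variable {S} in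
/-- The half-braiding of `C`. -/
def halfBraidingC (C : IdComparison S) : HalfBraiding (objC C) :=
  halfBraidingOfCells (lObj S.tensor) (lMap S.tensor) u.iso u.naturality
    (fun X Y => (lComp S.tensor X Y).hom) u.comp
    (fun X => C.nat₂ (pt E) (Y := pt E) (Y' := pt E) X)
    (fun η => C.nat₂_naturality S (pt E) (Y := pt E) (Y' := pt E) η)
    (fun X Y => C.nat₂_comp S (pt E) (Y := pt E) (Y' := pt E) (Y'' := pt E) X Y)

end OneObject

/-! ### Pastings as composites of whiskered cells -/

section General

open Bicategory
variable {𝒞 : Type u₁} [Bicategory.{w₁, v₁} 𝒞]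

/-- A 2-cell between composites of two 1-cells, whiskered on the right and rebracketed. -/
def whisker₂ {a b b' c d : 𝒞} {f : a ⟶ b} {g : b ⟶ c} {f' : a ⟶ b'} {g' : b' ⟶ c}
    (θ : f ≫ g ⟶ f' ≫ g') (h : c ⟶ d) : f ≫ g ≫ h ⟶ f' ≫ g' ≫ h :=
  (α_ f g h).inv ≫ θ ▷ h ≫ (α_ f' g' h).hom

/-- A 2-cell between composites of three 1-cells, whiskered on the right and rebracketed. -/
def whisker₃ {a b b' c c' d e : 𝒞} {f : a ⟶ b} {g : b ⟶ c} {h : c ⟶ d} {f' : a ⟶ b'}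
    {g' : b' ⟶ c'} {h' : c' ⟶ d} (θ : f ≫ g ≫ h ⟶ f' ≫ g' ≫ h') (k : d ⟶ e) :
    f ≫ g ≫ h ≫ k ⟶ f' ≫ g' ≫ h' ≫ k :=
  f ◁ (α_ g h k).inv ≫ (α_ f (g ≫ h) k).inv ≫ θ ▷ k ≫ (α_ f' (g' ≫ h') k).hom ≫
    f' ◁ (α_ g' h' k).hom

/-- Appending an identity to a composite of six 1-cells. -/
def appendId {a₀ a₁ a₂ a₃ a₄ a₅ a₆ : 𝒞} (f₁ : a₀ ⟶ a₁) (f₂ : a₁ ⟶ a₂) (f₃ : a₂ ⟶ a₃)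
    (f₄ : a₃ ⟶ a₄) (f₅ : a₄ ⟶ a₅) (f₆ : a₅ ⟶ a₆) :
    f₁ ≫ f₂ ≫ f₃ ≫ f₄ ≫ f₅ ≫ f₆ ≅ f₁ ≫ f₂ ≫ f₃ ≫ f₄ ≫ f₅ ≫ f₆ ≫ 𝟙 a₆ :=
  whiskerLeftIso f₁ (whiskerLeftIso f₂ (whiskerLeftIso f₃ (whiskerLeftIso f₄
    (whiskerLeftIso f₅ (ρ_ f₆).symm))))

/-- Bicategorical coherence for abstract cells. The appended identity gives every cell a tail, so
that all of them have the form `whisker₂` or `whisker₃`, including those at the right end. -/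
theorem first_pasting_eq {a₀ a₁ a₂ a₃ a₄ a₅ a₆ b₁ b₂ b₃ b₄ b₅ b₆ b₇ b₈ : 𝒞}
    {x₁ : a₀ ⟶ a₁} {x₂ : a₁ ⟶ a₂} {x₃ : a₂ ⟶ a₃} {c₁ : a₃ ⟶ a₄} {c₂ : a₄ ⟶ a₅} {c₃ : a₅ ⟶ a₆}
    {y₁ : a₀ ⟶ b₁} {y₂ : b₁ ⟶ b₂} {y₃ : b₂ ⟶ a₃} {d₁ : b₂ ⟶ b₃} {y₄ : b₃ ⟶ a₄}
    {d₂ : b₃ ⟶ b₄} {d₃ : b₄ ⟶ b₅} {z₁ : b₅ ⟶ a₆} {e₁ : b₁ ⟶ b₆} {e₂ : b₆ ⟶ b₇} {y₅ : b₇ ⟶ b₄}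
    {f₁ : a₀ ⟶ b₈} {y₆ : b₈ ⟶ b₆} {b₉ b₁₀ b₁₁ : 𝒞} {e₃ : b₇ ⟶ b₉} {y₇ : b₉ ⟶ b₅}
    {f₂ : b₈ ⟶ b₁₀} {f₃ : b₁₀ ⟶ b₁₁} {z₃ : b₁₁ ⟶ b₉}
    (s : x₁ ≫ x₂ ≫ x₃ ⟶ y₁ ≫ y₂ ≫ y₃) (n₁ : y₃ ≫ c₁ ⟶ d₁ ≫ y₄)
    (m₁ : y₄ ≫ c₂ ≫ c₃ ⟶ d₂ ≫ d₃ ≫ z₁) (m₂ : y₂ ≫ d₁ ≫ d₂ ⟶ e₁ ≫ e₂ ≫ y₅)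
    (n₂ : y₁ ≫ e₁ ⟶ f₁ ≫ y₆) (n₃ : y₅ ≫ d₃ ⟶ e₃ ≫ y₇) (m₃ : y₆ ≫ e₂ ≫ e₃ ⟶ f₂ ≫ f₃ ≫ z₃) :
    𝟙 _ ⊗≫ s ▷ (c₁ ≫ c₂ ≫ c₃) ⊗≫ (y₁ ≫ y₂) ◁ n₁ ▷ (c₂ ≫ c₃) ⊗≫ (y₁ ≫ y₂ ≫ d₁) ◁ m₁ ⊗≫
        y₁ ◁ m₂ ▷ (d₃ ≫ z₁) ⊗≫ n₂ ▷ (e₂ ≫ y₅ ≫ d₃ ≫ z₁) ⊗≫ (f₁ ≫ y₆ ≫ e₂) ◁ n₃ ▷ z₁ ⊗≫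
        f₁ ◁ m₃ ▷ (y₇ ≫ z₁) ⊗≫ 𝟙 _ =
      (appendId x₁ x₂ x₃ c₁ c₂ c₃).hom ≫ (whisker₃ s (c₁ ≫ c₂ ≫ c₃ ≫ 𝟙 _) ≫
        y₁ ◁ y₂ ◁ whisker₂ n₁ (c₂ ≫ c₃ ≫ 𝟙 _) ≫ y₁ ◁ y₂ ◁ d₁ ◁ whisker₃ m₁ (𝟙 _) ≫
        y₁ ◁ whisker₃ m₂ (d₃ ≫ z₁ ≫ 𝟙 _) ≫ whisker₂ n₂ (e₂ ≫ y₅ ≫ d₃ ≫ z₁ ≫ 𝟙 _) ≫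
        f₁ ◁ y₆ ◁ e₂ ◁ whisker₂ n₃ (z₁ ≫ 𝟙 _) ≫ f₁ ◁ whisker₃ m₃ (y₇ ≫ z₁ ≫ 𝟙 _)) ≫
        (appendId f₁ f₂ f₃ z₃ y₇ z₁).inv := by
  simp only [whisker₂, whisker₃, appendId, whiskerLeftIso_hom, whiskerLeftIso_inv, Iso.symm_hom,
    Iso.symm_inv]
  bicategory

theorem second_pasting_eq {a₀ a₁ a₂ a₃ a₄ a₅ a₆ b₁ b₂ b₃ b₄ b₅ b₆ b₇ b₈ b₉ b₁₀ b₁₁ : 𝒞}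
    {x₁ : a₀ ⟶ a₁} {x₂ : a₁ ⟶ a₂} {x₃ : a₂ ⟶ a₃} {c₁ : a₃ ⟶ a₄} {c₂ : a₄ ⟶ a₅} {c₃ : a₅ ⟶ a₆}
    {d₁ : a₂ ⟶ b₁} {d₂ : b₁ ⟶ b₂} {y₃ : b₂ ⟶ a₅} {e₁ : a₁ ⟶ b₃} {y₂ : b₃ ⟶ b₁}
    {d₃ : b₂ ⟶ b₄} {z₃ : b₄ ⟶ a₆} {e₂ : b₃ ⟶ b₅} {e₃ : b₅ ⟶ b₆} {z₂ : b₆ ⟶ b₄}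
    {f₁ : a₀ ⟶ b₇} {f₂ : b₇ ⟶ b₈} {y₁ : b₈ ⟶ b₅} {f₃ : b₈ ⟶ b₉} {z₁ : b₉ ⟶ b₆}
    {w₁ : b₉ ⟶ b₁₀} {w₂ : b₁₀ ⟶ b₁₁} {w₃ : b₁₁ ⟶ a₆}
    (m₁ : x₃ ≫ c₁ ≫ c₂ ⟶ d₁ ≫ d₂ ≫ y₃) (n₁ : x₂ ≫ d₁ ⟶ e₁ ≫ y₂) (n₂ : y₃ ≫ c₃ ⟶ d₃ ≫ z₃)
    (m₂ : y₂ ≫ d₂ ≫ d₃ ⟶ e₂ ≫ e₃ ≫ z₂) (m₃ : x₁ ≫ e₁ ≫ e₂ ⟶ f₁ ≫ f₂ ≫ y₁)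
    (n₃ : y₁ ≫ e₃ ⟶ f₃ ≫ z₁) (s : z₁ ≫ z₂ ≫ z₃ ⟶ w₁ ≫ w₂ ≫ w₃) :
    𝟙 _ ⊗≫ (x₁ ≫ x₂) ◁ m₁ ▷ c₃ ⊗≫ x₁ ◁ n₁ ▷ (d₂ ≫ y₃ ≫ c₃) ⊗≫ (x₁ ≫ e₁ ≫ y₂ ≫ d₂) ◁ n₂ ⊗≫
        (x₁ ≫ e₁) ◁ m₂ ▷ z₃ ⊗≫ m₃ ▷ (e₃ ≫ z₂ ≫ z₃) ⊗≫ (f₁ ≫ f₂) ◁ n₃ ▷ (z₂ ≫ z₃) ⊗≫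
        (f₁ ≫ f₂ ≫ f₃) ◁ s ⊗≫ 𝟙 _ =
      (appendId x₁ x₂ x₃ c₁ c₂ c₃).hom ≫ (x₁ ◁ x₂ ◁ whisker₃ m₁ (c₃ ≫ 𝟙 _) ≫
        x₁ ◁ whisker₂ n₁ (d₂ ≫ y₃ ≫ c₃ ≫ 𝟙 _) ≫ x₁ ◁ e₁ ◁ y₂ ◁ d₂ ◁ whisker₂ n₂ (𝟙 _) ≫
        x₁ ◁ e₁ ◁ whisker₃ m₂ (z₃ ≫ 𝟙 _) ≫ whisker₃ m₃ (e₃ ≫ z₂ ≫ z₃ ≫ 𝟙 _) ≫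
        f₁ ◁ f₂ ◁ whisker₂ n₃ (z₂ ≫ z₃ ≫ 𝟙 _) ≫ f₁ ◁ f₂ ◁ f₃ ◁ whisker₃ s (𝟙 _)) ≫
        (appendId f₁ f₂ f₃ w₁ w₂ w₃).inv := by
  simp only [whisker₂, whisker₃, appendId, whiskerLeftIso_hom, whiskerLeftIso_inv, Iso.symm_hom,
    Iso.symm_inv]
  bicategory

theorem map₃_id_hom {X X₁ X₂ Y₁ Y₂ Y : 𝒞} {a : X ⟶ X₁} {b : X₁ ⟶ X₂} {c : X₂ ⟶ Y}
    {d : X ⟶ Y₁} {e : Y₁ ⟶ Y₂} {f : Y₂ ⟶ Y} (φ : a ≫ b ≫ c ≅ d ≫ e ≫ f) :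
    (map₃ (Pseudofunctor.id 𝒞) φ).hom = φ.hom := by
  change a ◁ 𝟙 (b ≫ c) ≫ 𝟙 (a ≫ b ≫ c) ≫ φ.hom ≫ 𝟙 (d ≫ e ≫ f) ≫ d ◁ 𝟙 (e ≫ f) = _
  simp

end General

/-! ### Removing the functor `1 ⊗ -` cell by cell -/

section OneObject

open MonoidalCategory
variable {E : Type u} [Category.{v} E] [MonoidalCategory E]

theorem tripleWhisker_conj {X Y Z X' Y' Z' A B C A' B' C' W V : E} {f : X ⊗ Y ⊗ Z ⟶ X' ⊗ Y' ⊗ Z'}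
    {g : A ⊗ B ⊗ C ⟶ A' ⊗ B' ⊗ C'} {a : X ⟶ A} {b : Y ⟶ B} {c : Z ⟶ C} {a' : X' ⟶ A'}
    {b' : Y' ⟶ B'} {c' : Z' ⟶ C'} (w : W ⟶ V)
    (h : f ≫ (a' ⊗ₘ b' ⊗ₘ c') = (a ⊗ₘ b ⊗ₘ c) ≫ g) :
    tripleWhisker f W ≫ (a' ⊗ₘ b' ⊗ₘ c' ⊗ₘ w) = (a ⊗ₘ b ⊗ₘ c ⊗ₘ w) ≫ tripleWhisker g V := by
  have h' := congrArg (fun k => X ◁ (α_ Y Z W).inv ≫ (α_ X (Y ⊗ Z) W).inv ≫ (k ⊗ₘ w) ≫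
    (α_ A' (B' ⊗ C') V).hom ≫ A' ◁ (α_ B' C' V).hom) h
  simp only [tripleWhisker]
  refine Eq.trans ?_ (h'.trans ?_)
  · simp [MonoidalCategory.tensorHom_def]
  · simp [MonoidalCategory.tensorHom_def']

theorem doubleWhisker_conj {X Y X' Y' A B A' B' W V : E} {f : X ⊗ Y ⟶ X' ⊗ Y'}
    {g : A ⊗ B ⟶ A' ⊗ B'} {a : X ⟶ A} {b : Y ⟶ B} {a' : X' ⟶ A'} {b' : Y' ⟶ B'} (w : W ⟶ V)
    (h : f ≫ (a' ⊗ₘ b') = (a ⊗ₘ b) ≫ g) :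
    doubleWhisker f W ≫ (a' ⊗ₘ b' ⊗ₘ w) = (a ⊗ₘ b ⊗ₘ w) ≫ doubleWhisker g V := by
  have h' := congrArg (fun k => (α_ X Y W).inv ≫ (k ⊗ₘ w) ≫ (α_ A' B' V).hom) h
  simp only [doubleWhisker]
  refine Eq.trans ?_ (h'.trans ?_)
  · simp [MonoidalCategory.tensorHom_def]
  · simp [MonoidalCategory.tensorHom_def']

theorem whiskerLeft_conj {X A W W' V V' : E} {f : W ⟶ W'} {g : V ⟶ V'} {j : W ⟶ V} {j' : W' ⟶ V'}
    (a : X ⟶ A) (h : f ≫ j' = j ≫ g) : X ◁ f ≫ (a ⊗ₘ j') = (a ⊗ₘ j) ≫ A ◁ g := by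
  rw [MonoidalCategory.tensorHom_def', ← MonoidalCategory.whiskerLeft_comp_assoc, h,
    MonoidalCategory.tensorHom_def']
  rw [Category.assoc, ← whisker_exchange, MonoidalCategory.whiskerLeft_comp, Category.assoc]

/-- Stacks two intertwining squares; a whole pasting is transported along the identification by
iterating this. -/
theorem comp_conj {E : Type u} [Category.{v} E] {X X' X'' Y Y' Y'' : E} {f : X ⟶ X'}
    {f' : X' ⟶ X''} {g : Y ⟶ Y'}
    {g' : Y' ⟶ Y''} {j : X ⟶ Y} {j' : X' ⟶ Y'} {j'' : X'' ⟶ Y''} (h : f ≫ j' = j ≫ g)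
    (h' : f' ≫ j'' = j' ≫ g') : (f ≫ f') ≫ j'' = j ≫ g ≫ g' := by
  rw [Category.assoc, h', reassoc_of% h]

variable (S : WeakBData (MonoidalSingleObj E)) (u : UnitIdentification S.tensor)

/-- The 2-cell `γ` in the monoidal category `E`. -/
def hexCell : objB S ⊗ lObj S.tensor (objB S) ⊗ objB S ≅
    lObj S.tensor (objB S) ⊗ objB S ⊗ lObj S.tensor (objB S) :=
  S.hex (pt E) (pt E) (pt E) (pt E)

/-- The 2-cell `b_{1,1,X}` in the monoidal category `E`. -/
def b₃Cell (X : E) : objB S ⊗ lObj S.tensor (lObj S.tensor X) ≅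
    lObj S.tensor (lObj S.tensor X) ⊗ objB S :=
  S.b₃ (pt E) (pt E) (Z := pt E) (Z' := pt E) X

theorem hexCell_conj : (hexCell S).hom ≫
      ((u.iso (objB S)).hom ⊗ₘ (𝟙 (objB S) ⊗ₘ (u.iso (objB S)).hom)) =
    (𝟙 (objB S) ⊗ₘ ((u.iso (objB S)).hom ⊗ₘ 𝟙 (objB S))) ≫ (autS S u).hom := by
  have h : autS S u = whiskerLeftIso (objB S) (whiskerRightIso (u.iso (objB S)).symm (objB S)) ≪≫
    hexCell S ≪≫ ((u.iso (objB S)) ⊗ᵢ (whiskerLeftIso (objB S) (u.iso (objB S)))) := rfl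
  simp [h]

theorem b₃Cell_conj (X : E) : (b₃Cell S X).hom ≫ ((ident₂ S u X).hom ⊗ₘ 𝟙 (objB S)) =
    (𝟙 (objB S) ⊗ₘ (ident₂ S u X).hom) ≫ (tB S u X).hom := by
  have h : tB S u X = whiskerLeftIso (objB S) (ident₂ S u X).symm ≪≫ b₃Cell S X ≪≫
    whiskerRightIso (ident₂ S u X) (objB S) := rfl
  simp [h]

variable {S}

/-- The pseudo-naturality 2-cell of `C` in the monoidal category `E`. -/
def nat₂Cell (C : IdComparison S) (X : E) : lObj S.tensor X ⊗ objC C ≅ objC C ⊗ lObj S.tensor X :=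
  C.nat₂ (pt E) (Y := pt E) (Y' := pt E) X

/-- The inverse appears because the pseudo-naturality cell moves `C` to the left, whereas `tC` moves
it to the right. -/
theorem nat₂Cell_conj (C : IdComparison S) (X : E) :
    (nat₂Cell C X).hom ≫ (𝟙 (objC C) ⊗ₘ (u.iso X).hom) =
      ((u.iso X).hom ⊗ₘ 𝟙 (objC C)) ≫ (tC u C X).inv := by
  have h : tC u C X = whiskerLeftIso (objC C) (u.iso X).symm ≪≫ (nat₂Cell C X).symm ≪≫
    whiskerRightIso (u.iso X) (objC C) := rfl
  simp [h]

/-- The 2-cell `1 ⊗ φ` in the monoidal category `E`. -/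
def lCell (T : TensorProduct (MonoidalSingleObj E)) {a b c d e f : E}
    (φ : a ⊗ b ⊗ c ≅ d ⊗ e ⊗ f) :
    lObj T a ⊗ lObj T b ⊗ lObj T c ≅ lObj T d ⊗ lObj T e ⊗ lObj T f :=
  map₃ (X := pt E) (X₁ := pt E) (X₂ := pt E) (Y₁ := pt E) (Y₂ := pt E) (Y := pt E)
    (lt T (pt E)) φ

/-- Compatibility of the identification with composition absorbs the constraints in `1 ⊗ φ`, and its
naturality removes `1 ⊗ -` from `φ`. -/
theorem lCell_conj {a b c d e f : E} (φ : a ⊗ b ⊗ c ≅ d ⊗ e ⊗ f) :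
    (lCell S.tensor φ).hom ≫ ((u.iso d).hom ⊗ₘ (u.iso e).hom ⊗ₘ (u.iso f).hom) =
      ((u.iso a).hom ⊗ₘ (u.iso b).hom ⊗ₘ (u.iso c).hom) ≫ φ.hom := by
  have h (a b c : E) : (lComp S.tensor a (b ⊗ c)).hom ≫ lObj S.tensor a ◁ (lComp S.tensor b c).hom ≫
      ((u.iso a).hom ⊗ₘ (u.iso b).hom ⊗ₘ (u.iso c).hom) = (u.iso (a ⊗ b ⊗ c)).hom := by
    rw [← u.comp, ← u.comp b c, ← id_tensorHom, tensorHom_comp_tensorHom, Category.id_comp]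
  have h' : (lCell S.tensor φ).hom = lObj S.tensor a ◁ (lComp S.tensor b c).inv ≫
      (lComp S.tensor a (b ⊗ c)).inv ≫ lMap S.tensor φ.hom ≫ (lComp S.tensor d (e ⊗ f)).hom ≫
      lObj S.tensor d ◁ (lComp S.tensor e f).hom := rfl
  rw [h']
  simp only [Category.assoc]
  rw [h, u.naturality, ← h, Category.assoc, Category.assoc, Iso.inv_hom_id_assoc,
    whiskerLeft_inv_hom_assoc]

variable (Φ : WeakBFunctorData S S (Pseudofunctor.id (MonoidalSingleObj E)))

/-- The 2-cell `φ` in the monoidal category `E`. -/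
def φCell : objB S ⊗ objC Φ.cmp ⊗ lObj S.tensor (objC Φ.cmp) ≅
    objC Φ.cmp ⊗ lObj S.tensor (objC Φ.cmp) ⊗ objB S :=
  Φ.φ (pt E) (pt E) (pt E)

theorem φCell_conj : (φCell Φ).hom ≫
      (𝟙 (objC Φ.cmp) ⊗ₘ (u.iso (objC Φ.cmp)).hom ⊗ₘ 𝟙 (objB S)) =
    (𝟙 (objB S) ⊗ₘ 𝟙 (objC Φ.cmp) ⊗ₘ (u.iso (objC Φ.cmp)).hom) ≫ (cellM u Φ).hom := by
  have h : (cellM u Φ).hom = (objB S ◁ objC Φ.cmp ◁ (u.iso (objC Φ.cmp)).inv) ≫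
    (φCell Φ).hom ≫ objC Φ.cmp ◁ (u.iso (objC Φ.cmp)).hom ▷ objB S := rfl
  simp [h]

/-- The outer `1 ⊗ -` is removed by `lCell_conj`, the inner one on `C` by `φCell_conj`; this is why
`ident₂` occurs. Hence `φ` and `1 ⊗ φ` both become `M`. -/
theorem lCell_φCell_conj : (lCell S.tensor (φCell Φ)).hom ≫ ((u.iso (objC Φ.cmp)).hom ⊗ₘ
        (ident₂ S u (objC Φ.cmp)).hom ⊗ₘ (u.iso (objB S)).hom) =
      ((u.iso (objB S)).hom ⊗ₘ (u.iso (objC Φ.cmp)).hom ⊗ₘ (ident₂ S u (objC Φ.cmp)).hom) ≫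
        (cellM u Φ).hom := by
  have h₁ : ((u.iso (objC Φ.cmp)).hom ⊗ₘ (ident₂ S u (objC Φ.cmp)).hom ⊗ₘ (u.iso (objB S)).hom) =
      ((u.iso (objC Φ.cmp)).hom ⊗ₘ (u.iso (lObj S.tensor (objC Φ.cmp))).hom ⊗ₘ
        (u.iso (objB S)).hom) ≫
      (𝟙 (objC Φ.cmp) ⊗ₘ (u.iso (objC Φ.cmp)).hom ⊗ₘ 𝟙 (objB S)) := by
    simp only [tensorHom_comp_tensorHom, Category.comp_id, ident₂, Iso.trans_hom]
  have h₂ : ((u.iso (objB S)).hom ⊗ₘ (u.iso (objC Φ.cmp)).hom ⊗ₘ (ident₂ S u (objC Φ.cmp)).hom) =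
      ((u.iso (objB S)).hom ⊗ₘ (u.iso (objC Φ.cmp)).hom ⊗ₘ
        (u.iso (lObj S.tensor (objC Φ.cmp))).hom) ≫
      (𝟙 (objB S) ⊗ₘ 𝟙 (objC Φ.cmp) ⊗ₘ (u.iso (objC Φ.cmp)).hom) := by
    simp only [tensorHom_comp_tensorHom, Category.comp_id, ident₂, Iso.trans_hom]
  rw [h₁, h₂, Category.assoc, ← φCell_conj, ← Category.assoc, lCell_conj, Category.assoc]

end OneObject

/-! ### The coherence condition as an equation in `E` -/

section OneObject

open MonoidalCategory
variable {E : Type u} [Category.{v} E] [MonoidalCategory E]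

/-- Appending a unit to a tensor product of six objects. -/
def appendUnit (X₁ X₂ X₃ X₄ X₅ X₆ : E) :
    X₁ ⊗ X₂ ⊗ X₃ ⊗ X₄ ⊗ X₅ ⊗ X₆ ≅ X₁ ⊗ X₂ ⊗ X₃ ⊗ X₄ ⊗ X₅ ⊗ X₆ ⊗ 𝟙_ E :=
  whiskerLeftIso X₁ (whiskerLeftIso X₂ (whiskerLeftIso X₃ (whiskerLeftIso X₄
    (whiskerLeftIso X₅ (ρ_ X₆).symm))))

variable {S : WeakBData (MonoidalSingleObj E)} (u : UnitIdentification S.tensor)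
  (Φ : WeakBFunctorData S S (Pseudofunctor.id (MonoidalSingleObj E)))

/-- The source of the coherence condition for `φ`. -/
abbrev srcWord : E :=
  objB S ⊗ lObj S.tensor (objB S) ⊗ objB S ⊗ objC Φ.cmp ⊗ lObj S.tensor (objC Φ.cmp) ⊗
    lObj S.tensor (lObj S.tensor (objC Φ.cmp))

/-- The target of the coherence condition for `φ`. -/
abbrev tgtWord : E :=
  objC Φ.cmp ⊗ lObj S.tensor (objC Φ.cmp) ⊗ lObj S.tensor (lObj S.tensor (objC Φ.cmp)) ⊗
    lObj S.tensor (objB S) ⊗ objB S ⊗ lObj S.tensor (objB S)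

/-- The first pasting in the monoidal category `E`. -/
def pastingCell₁ : srcWord Φ ⟶ tgtWord Φ := Φ.pasting₁ (pt E) (pt E) (pt E) (pt E)

/-- The second pasting in the monoidal category `E`. -/
def pastingCell₂ : srcWord Φ ⟶ tgtWord Φ := Φ.pasting₂ (pt E) (pt E) (pt E) (pt E)

section Pastings

local notation "B" => objB S
local notation "PB" => lObj S.tensor (objB S)
local notation "C" => objC (WeakBFunctorData.cmp Φ)
local notation "PC" => lObj S.tensor (objC (WeakBFunctorData.cmp Φ))
local notation "PPC" => lObj S.tensor (lObj S.tensor (objC (WeakBFunctorData.cmp Φ)))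

theorem pastingCell₁_eq : pastingCell₁ Φ =
    (appendUnit B PB B C PC PPC).hom ≫ (tripleWhisker (hexCell S).hom (C ⊗ PC ⊗ PPC ⊗ 𝟙_ E) ≫
      PB ◁ B ◁ doubleWhisker (nat₂Cell Φ.cmp B).hom (PC ⊗ PPC ⊗ 𝟙_ E) ≫
      PB ◁ B ◁ C ◁ tripleWhisker (lCell S.tensor (φCell Φ)).hom (𝟙_ E) ≫
      PB ◁ tripleWhisker (φCell Φ).hom (PPC ⊗ PB ⊗ 𝟙_ E) ≫
      doubleWhisker (nat₂Cell Φ.cmp B).hom (PC ⊗ B ⊗ PPC ⊗ PB ⊗ 𝟙_ E) ≫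
      C ◁ PB ◁ PC ◁ doubleWhisker (b₃Cell S C).hom (PB ⊗ 𝟙_ E) ≫
      C ◁ tripleWhisker (lCell S.tensor (φCell Φ)).hom (B ⊗ PB ⊗ 𝟙_ E)) ≫
      (appendUnit C PC PPC PB B PB).inv := by
  have h := map₃_id_hom (S.hex (pt E) (pt E) (pt E) (pt E))
  unfold pastingCell₁ WeakBFunctorData.pasting₁
  rw [h]
  exact first_pasting_eq (𝒞 := MonoidalSingleObj E) _ _ _ _ _ _ _

theorem pastingCell₂_eq : pastingCell₂ Φ =
    (appendUnit B PB B C PC PPC).hom ≫ (B ◁ PB ◁ tripleWhisker (φCell Φ).hom (PPC ⊗ 𝟙_ E) ≫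
      B ◁ doubleWhisker (nat₂Cell Φ.cmp B).hom (PC ⊗ B ⊗ PPC ⊗ 𝟙_ E) ≫
      B ◁ C ◁ PB ◁ PC ◁ doubleWhisker (b₃Cell S C).hom (𝟙_ E) ≫
      B ◁ C ◁ tripleWhisker (lCell S.tensor (φCell Φ)).hom (B ⊗ 𝟙_ E) ≫
      tripleWhisker (φCell Φ).hom (PPC ⊗ PB ⊗ B ⊗ 𝟙_ E) ≫
      C ◁ PC ◁ doubleWhisker (b₃Cell S C).hom (PB ⊗ B ⊗ 𝟙_ E) ≫
      C ◁ PC ◁ PPC ◁ tripleWhisker (hexCell S).hom (𝟙_ E)) ≫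
      (appendUnit C PC PPC PB B PB).inv := by
  exact second_pasting_eq (𝒞 := MonoidalSingleObj E) _ _ _ _ _ _ _

/-- The identification of the source word, with a unit appended. -/
def srcIso : B ⊗ PB ⊗ B ⊗ C ⊗ PC ⊗ PPC ⊗ 𝟙_ E ≅ B ⊗ B ⊗ B ⊗ C ⊗ C ⊗ C ⊗ 𝟙_ E :=
  Iso.refl B ⊗ᵢ u.iso B ⊗ᵢ Iso.refl B ⊗ᵢ Iso.refl C ⊗ᵢ u.iso C ⊗ᵢ ident₂ S u C ⊗ᵢ Iso.refl (𝟙_ E)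

/-- The identification of the target word, with a unit appended. -/
def tgtIso : C ⊗ PC ⊗ PPC ⊗ PB ⊗ B ⊗ PB ⊗ 𝟙_ E ≅ C ⊗ C ⊗ C ⊗ B ⊗ B ⊗ B ⊗ 𝟙_ E :=
  Iso.refl C ⊗ᵢ u.iso C ⊗ᵢ ident₂ S u C ⊗ᵢ u.iso B ⊗ᵢ Iso.refl B ⊗ᵢ u.iso B ⊗ᵢ Iso.refl (𝟙_ E)

theorem pastingCell₁_conj :
    (tripleWhisker (hexCell S).hom (C ⊗ PC ⊗ PPC ⊗ 𝟙_ E) ≫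
      PB ◁ B ◁ doubleWhisker (nat₂Cell Φ.cmp B).hom (PC ⊗ PPC ⊗ 𝟙_ E) ≫
      PB ◁ B ◁ C ◁ tripleWhisker (lCell S.tensor (φCell Φ)).hom (𝟙_ E) ≫
      PB ◁ tripleWhisker (φCell Φ).hom (PPC ⊗ PB ⊗ 𝟙_ E) ≫
      doubleWhisker (nat₂Cell Φ.cmp B).hom (PC ⊗ B ⊗ PPC ⊗ PB ⊗ 𝟙_ E) ≫
      C ◁ PB ◁ PC ◁ doubleWhisker (b₃Cell S C).hom (PB ⊗ 𝟙_ E) ≫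
      C ◁ tripleWhisker (lCell S.tensor (φCell Φ)).hom (B ⊗ PB ⊗ 𝟙_ E)) ≫ (tgtIso u Φ).hom =
    (srcIso u Φ).hom ≫ tripleWhisker (autS S u).hom (C ⊗ C ⊗ C ⊗ 𝟙_ E) ≫
      B ◁ B ◁ doubleWhisker (tC u Φ.cmp B).inv (C ⊗ C ⊗ 𝟙_ E) ≫
      B ◁ B ◁ C ◁ tripleWhisker (cellM u Φ).hom (𝟙_ E) ≫
      B ◁ tripleWhisker (cellM u Φ).hom (C ⊗ B ⊗ 𝟙_ E) ≫
      doubleWhisker (tC u Φ.cmp B).inv (C ⊗ B ⊗ C ⊗ B ⊗ 𝟙_ E) ≫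
      C ◁ B ◁ C ◁ doubleWhisker (tB S u C).hom (B ⊗ 𝟙_ E) ≫
      C ◁ tripleWhisker (cellM u Φ).hom (B ⊗ B ⊗ 𝟙_ E) :=
  comp_conj (tripleWhisker_conj _ (hexCell_conj S u)) <|
  comp_conj (whiskerLeft_conj _ (whiskerLeft_conj _ (doubleWhisker_conj _
      (nat₂Cell_conj u _ _)))) <|
  comp_conj (whiskerLeft_conj _ (whiskerLeft_conj _ (whiskerLeft_conj _
    (tripleWhisker_conj _ (lCell_φCell_conj u Φ))))) <|
  comp_conj (whiskerLeft_conj _ (tripleWhisker_conj _ (φCell_conj u Φ))) <|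
  comp_conj (doubleWhisker_conj _ (nat₂Cell_conj u _ _)) <|
  comp_conj (whiskerLeft_conj _ (whiskerLeft_conj _ (whiskerLeft_conj _
    (doubleWhisker_conj _ (b₃Cell_conj S u _))))) <|
  whiskerLeft_conj _ (tripleWhisker_conj _ (lCell_φCell_conj u Φ))

theorem pastingCell₂_conj :
    (B ◁ PB ◁ tripleWhisker (φCell Φ).hom (PPC ⊗ 𝟙_ E) ≫
      B ◁ doubleWhisker (nat₂Cell Φ.cmp B).hom (PC ⊗ B ⊗ PPC ⊗ 𝟙_ E) ≫
      B ◁ C ◁ PB ◁ PC ◁ doubleWhisker (b₃Cell S C).hom (𝟙_ E) ≫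
      B ◁ C ◁ tripleWhisker (lCell S.tensor (φCell Φ)).hom (B ⊗ 𝟙_ E) ≫
      tripleWhisker (φCell Φ).hom (PPC ⊗ PB ⊗ B ⊗ 𝟙_ E) ≫
      C ◁ PC ◁ doubleWhisker (b₃Cell S C).hom (PB ⊗ B ⊗ 𝟙_ E) ≫
      C ◁ PC ◁ PPC ◁ tripleWhisker (hexCell S).hom (𝟙_ E)) ≫ (tgtIso u Φ).hom =
    (srcIso u Φ).hom ≫ B ◁ B ◁ tripleWhisker (cellM u Φ).hom (C ⊗ 𝟙_ E) ≫
      B ◁ doubleWhisker (tC u Φ.cmp B).inv (C ⊗ B ⊗ C ⊗ 𝟙_ E) ≫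
      B ◁ C ◁ B ◁ C ◁ doubleWhisker (tB S u C).hom (𝟙_ E) ≫
      B ◁ C ◁ tripleWhisker (cellM u Φ).hom (B ⊗ 𝟙_ E) ≫
      tripleWhisker (cellM u Φ).hom (C ⊗ B ⊗ B ⊗ 𝟙_ E) ≫
      C ◁ C ◁ doubleWhisker (tB S u C).hom (B ⊗ B ⊗ 𝟙_ E) ≫
      C ◁ C ◁ C ◁ tripleWhisker (autS S u).hom (𝟙_ E) :=
  comp_conj (whiskerLeft_conj _ (whiskerLeft_conj _ (tripleWhisker_conj _ (φCell_conj u Φ)))) <|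
  comp_conj (whiskerLeft_conj _ (doubleWhisker_conj _ (nat₂Cell_conj u _ _))) <|
  comp_conj (whiskerLeft_conj _ (whiskerLeft_conj _ (whiskerLeft_conj _ (whiskerLeft_conj _
    (doubleWhisker_conj _ (b₃Cell_conj S u _)))))) <|
  comp_conj (whiskerLeft_conj _ (whiskerLeft_conj _ (tripleWhisker_conj _
      (lCell_φCell_conj u Φ)))) <|
  comp_conj (tripleWhisker_conj _ (φCell_conj u Φ)) <|
  comp_conj (whiskerLeft_conj _ (whiskerLeft_conj _ (doubleWhisker_conj _ (b₃Cell_conj S u _)))) <|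
  whiskerLeft_conj _ (whiskerLeft_conj _ (whiskerLeft_conj _ (tripleWhisker_conj _
      (hexCell_conj S u))))

theorem coherent_iff : Φ.Coherent ↔
    tripleWhisker (autS S u).hom (C ⊗ C ⊗ C ⊗ 𝟙_ E) ≫
      B ◁ B ◁ doubleWhisker (tC u Φ.cmp B).inv (C ⊗ C ⊗ 𝟙_ E) ≫
      B ◁ B ◁ C ◁ tripleWhisker (cellM u Φ).hom (𝟙_ E) ≫
      B ◁ tripleWhisker (cellM u Φ).hom (C ⊗ B ⊗ 𝟙_ E) ≫
      doubleWhisker (tC u Φ.cmp B).inv (C ⊗ B ⊗ C ⊗ B ⊗ 𝟙_ E) ≫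
      C ◁ B ◁ C ◁ doubleWhisker (tB S u C).hom (B ⊗ 𝟙_ E) ≫
      C ◁ tripleWhisker (cellM u Φ).hom (B ⊗ B ⊗ 𝟙_ E) =
    B ◁ B ◁ tripleWhisker (cellM u Φ).hom (C ⊗ 𝟙_ E) ≫
      B ◁ doubleWhisker (tC u Φ.cmp B).inv (C ⊗ B ⊗ C ⊗ 𝟙_ E) ≫
      B ◁ C ◁ B ◁ C ◁ doubleWhisker (tB S u C).hom (𝟙_ E) ≫
      B ◁ C ◁ tripleWhisker (cellM u Φ).hom (B ⊗ 𝟙_ E) ≫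
      tripleWhisker (cellM u Φ).hom (C ⊗ B ⊗ B ⊗ 𝟙_ E) ≫
      C ◁ C ◁ doubleWhisker (tB S u C).hom (B ⊗ B ⊗ 𝟙_ E) ≫
      C ◁ C ◁ C ◁ tripleWhisker (autS S u).hom (𝟙_ E) := by
  -- All objects are definitionally equal to the point, so one instance of the condition is all of
  -- it.
  have h : Φ.Coherent ↔ pastingCell₁ Φ = pastingCell₂ Φ :=
    ⟨fun h => h (pt E) (pt E) (pt E) (pt E), fun h _ _ _ _ => h⟩
  rw [h, pastingCell₁_eq, pastingCell₂_eq, Iso.cancel_iso_hom_left, Iso.cancel_iso_inv_right,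
    ← Iso.cancel_iso_hom_right _ _ (tgtIso u Φ), pastingCell₁_conj, pastingCell₂_conj,
    Iso.cancel_iso_hom_left]

end Pastings

/-- Two opposite composites of four isomorphisms agree if and only if the composites of the
inverses of three of them do. -/
theorem opposite_products_iff {E : Type u} [Category.{v} E] {X : E} (z a b c : X ≅ X) :
    z ≪≫ c ≪≫ b ≪≫ a = a ≪≫ b ≪≫ c ≪≫ z ↔
      z.hom ≫ a.inv ≫ b.inv ≫ c.inv = c.inv ≫ b.inv ≫ a.inv ≫ z.hom := by
  have h : z ≪≫ c ≪≫ b ≪≫ a = a ≪≫ b ≪≫ c ≪≫ z ↔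
      (z ≪≫ c ≪≫ b ≪≫ a).hom = (a ≪≫ b ≪≫ c ≪≫ z).hom := ⟨fun h => by rw [h], fun h => Iso.ext h⟩
  rw [h, ← Iso.cancel_iso_inv_right _ _ a, ← Iso.cancel_iso_inv_right _ _ b,
    ← Iso.cancel_iso_inv_right _ _ c, ← Iso.cancel_iso_inv_left a,
    ← Iso.cancel_iso_inv_left b, ← Iso.cancel_iso_inv_left c]
  simp only [Iso.trans_hom, Category.assoc, Iso.hom_inv_id, Category.comp_id,
    Iso.inv_hom_id_assoc]
  exact eq_comm

end OneObject

/-! ### The relation for `L` and the inverse assignments -/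

section OneObject

open MonoidalCategory
variable {E : Type u} [Category.{v} E] [MonoidalCategory E]

theorem comp_rightUnitor_inv_of_two {X Y X' Y' : E} (f : X ⊗ Y ⟶ X' ⊗ Y') :
    f ≫ X' ◁ (ρ_ Y').inv = X ◁ (ρ_ Y).inv ≫ doubleWhisker f (𝟙_ E) := by
  simp [doubleWhisker]

theorem comp_rightUnitor_inv_of_three {X Y Z X' Y' Z' : E} (f : X ⊗ Y ⊗ Z ⟶ X' ⊗ Y' ⊗ Z') :
    f ≫ X' ◁ Y' ◁ (ρ_ Z').inv = X ◁ Y ◁ (ρ_ Z).inv ≫ tripleWhisker f (𝟙_ E) := by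
  simp [tripleWhisker]

theorem whiskerLeft_comm {W W' V V' : E} (X : E) {f : W ⟶ W'} {g : V ⟶ V'} {j : W ⟶ V}
    {j' : W' ⟶ V'} (h : f ≫ j' = j ≫ g) : X ◁ f ≫ X ◁ j' = X ◁ j ≫ X ◁ g := by
  rw [← MonoidalCategory.whiskerLeft_comp, h, MonoidalCategory.whiskerLeft_comp]

theorem inv_eq_hom_of_trans_eq_refl {E : Type u} [Category.{v} E] {X Y : E} {i : X ≅ Y} {k : Y ≅ X}
    (h : i ≪≫ k = Iso.refl X) : i.inv = k.hom :=
  Iso.inv_ext (congrArg Iso.hom h)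

theorem onThree_inv {X Y Z : E} (L : X ⊗ Y ⊗ Z ≅ X ⊗ Y ⊗ Z) (W : E) :
    (onThree L W).inv = tripleWhisker L.inv W := by
  simp [onThree, tripleWhisker]

theorem onTwo_inv {X Y X' Y' : E} (t : X ⊗ Y ≅ Y' ⊗ X') (W : E) :
    (onTwo t W).inv = doubleWhisker t.inv W := by
  simp [onTwo, doubleWhisker]

theorem onTwo_hom {X Y X' Y' : E} (t : X ⊗ Y ≅ Y' ⊗ X') (W : E) :
    (onTwo t W).hom = doubleWhisker t.hom W := rfl

variable {S : WeakBData (MonoidalSingleObj E)} (u : UnitIdentification S.tensor) (p : Pair S)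

section Relation

local notation "B" => objB S
local notation "C" => objC (Pair.C p)
local notation "tBB" => Iso.hom (tB S u (objB S))
local notation "tBC" => Iso.hom (tB S u (objC (Pair.C p)))
local notation "tCB" => Iso.hom (tC u (Pair.C p) (objB S))
local notation "tCC" => Iso.hom (tC u (Pair.C p) (objC (Pair.C p)))

/-- The relation is rewritten in terms of `L⁻¹`, the coupon occurring in `M`, with a unit appended.
Symmetry of the half-braidings turns the inverse crossings in the conjugations into crossings. -/
theorem relation_iff (hBB : tB S u B ≪≫ tB S u B = Iso.refl _)
    (hp : SymmetricHalfBraidings u p.C) :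
    p.Relation u ↔
      (C ◁ C ◁ C ◁ tripleWhisker (autZ S u).hom (𝟙_ E)) ≫
        (C ◁ C ◁ doubleWhisker tCB (B ⊗ B ⊗ 𝟙_ E) ≫ tripleWhisker p.L.inv (C ⊗ B ⊗ B ⊗ 𝟙_ E) ≫
          C ◁ C ◁ doubleWhisker tBC (B ⊗ B ⊗ 𝟙_ E)) ≫
        (C ◁ doubleWhisker tCC (B ⊗ B ⊗ B ⊗ 𝟙_ E) ≫
          C ◁ C ◁ C ◁ doubleWhisker tBB (B ⊗ 𝟙_ E) ≫
          C ◁ C ◁ doubleWhisker tCB (B ⊗ B ⊗ 𝟙_ E) ≫ tripleWhisker p.L.inv (C ⊗ B ⊗ B ⊗ 𝟙_ E) ≫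
          C ◁ C ◁ doubleWhisker tBC (B ⊗ B ⊗ 𝟙_ E) ≫ C ◁ C ◁ C ◁ doubleWhisker tBB (B ⊗ 𝟙_ E) ≫
          C ◁ doubleWhisker tCC (B ⊗ B ⊗ B ⊗ 𝟙_ E)) ≫
        (C ◁ C ◁ C ◁ B ◁ doubleWhisker tBB (𝟙_ E) ≫ C ◁ C ◁ C ◁ doubleWhisker tBB (B ⊗ 𝟙_ E) ≫
          C ◁ tripleWhisker p.L.inv (B ⊗ B ⊗ 𝟙_ E) ≫ C ◁ C ◁ C ◁ doubleWhisker tBB (B ⊗ 𝟙_ E) ≫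
          C ◁ C ◁ C ◁ B ◁ doubleWhisker tBB (𝟙_ E)) =
      (C ◁ C ◁ C ◁ B ◁ doubleWhisker tBB (𝟙_ E) ≫ C ◁ C ◁ C ◁ doubleWhisker tBB (B ⊗ 𝟙_ E) ≫
          C ◁ tripleWhisker p.L.inv (B ⊗ B ⊗ 𝟙_ E) ≫ C ◁ C ◁ C ◁ doubleWhisker tBB (B ⊗ 𝟙_ E) ≫
          C ◁ C ◁ C ◁ B ◁ doubleWhisker tBB (𝟙_ E)) ≫
        (C ◁ doubleWhisker tCC (B ⊗ B ⊗ B ⊗ 𝟙_ E) ≫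
          C ◁ C ◁ C ◁ doubleWhisker tBB (B ⊗ 𝟙_ E) ≫
          C ◁ C ◁ doubleWhisker tCB (B ⊗ B ⊗ 𝟙_ E) ≫ tripleWhisker p.L.inv (C ⊗ B ⊗ B ⊗ 𝟙_ E) ≫
          C ◁ C ◁ doubleWhisker tBC (B ⊗ B ⊗ 𝟙_ E) ≫ C ◁ C ◁ C ◁ doubleWhisker tBB (B ⊗ 𝟙_ E) ≫
          C ◁ doubleWhisker tCC (B ⊗ B ⊗ B ⊗ 𝟙_ E)) ≫
        (C ◁ C ◁ doubleWhisker tCB (B ⊗ B ⊗ 𝟙_ E) ≫ tripleWhisker p.L.inv (C ⊗ B ⊗ B ⊗ 𝟙_ E) ≫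
          C ◁ C ◁ doubleWhisker tBC (B ⊗ B ⊗ 𝟙_ E)) ≫
        C ◁ C ◁ C ◁ tripleWhisker (autZ S u).hom (𝟙_ E) := by
  have hBB' : (tB S u B).inv = tBB := inv_eq_hom_of_trans_eq_refl hBB
  have hCB' : (tC u p.C B).inv = tBC := inv_eq_hom_of_trans_eq_refl hp.2.1
  have hCC' : (tC u p.C C).inv = tCC := inv_eq_hom_of_trans_eq_refl hp.2.2
  -- Appending the unit intertwines each factor with its version carrying the tail `𝟙_ E`.
  let j : C ⊗ C ⊗ C ⊗ B ⊗ B ⊗ B ⟶ C ⊗ C ⊗ C ⊗ B ⊗ B ⊗ B ⊗ 𝟙_ E := (appendUnit C C C B B B).hom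
  have hz : (p.Z₄₅₆ u).hom ≫ j = j ≫ C ◁ C ◁ C ◁ tripleWhisker (autZ S u).hom (𝟙_ E) :=
    whiskerLeft_comm _ (whiskerLeft_comm _ (whiskerLeft_comm _ (comp_rightUnitor_inv_of_three _)))
  have ht₁ {X Y X' Y' : E} (f : X ⊗ Y ⟶ X' ⊗ Y') : (C ◁ C ◁ doubleWhisker f (B ⊗ B)) ≫
      C ◁ C ◁ X' ◁ Y' ◁ B ◁ (ρ_ B).inv =
      (C ◁ C ◁ X ◁ Y ◁ B ◁ (ρ_ B).inv) ≫ C ◁ C ◁ doubleWhisker f (B ⊗ B ⊗ 𝟙_ E) :=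
    whiskerLeft_comm _ (whiskerLeft_comm _ (doubleWhisker_comp_whiskerLeft _ _))
  have ht₂ : (C ◁ doubleWhisker tCC (B ⊗ B ⊗ B)) ≫ j = j ≫ C ◁ doubleWhisker tCC
      (B ⊗ B ⊗ B ⊗ 𝟙_ E) :=
    whiskerLeft_comm _ (doubleWhisker_comp_whiskerLeft _ _)
  have ht₄ : (C ◁ C ◁ C ◁ doubleWhisker tBB B) ≫ j = j ≫ C ◁ C ◁ C ◁ doubleWhisker tBB (B ⊗ 𝟙_ E) :=
    whiskerLeft_comm _ (whiskerLeft_comm _ (whiskerLeft_comm _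
        (doubleWhisker_comp_whiskerLeft _ _)))
  have ht₅ : (C ◁ C ◁ C ◁ B ◁ tBB) ≫ j = j ≫ C ◁ C ◁ C ◁ B ◁ doubleWhisker tBB (𝟙_ E) :=
    whiskerLeft_comm _ (whiskerLeft_comm _ (whiskerLeft_comm _ (whiskerLeft_comm _
      (comp_rightUnitor_inv_of_two _))))
  have hN : tripleWhisker p.L.inv (C ⊗ B ⊗ B) ≫ C ◁ C ◁ B ◁ C ◁ B ◁ (ρ_ B).inv =
      (C ◁ C ◁ B ◁ C ◁ B ◁ (ρ_ B).inv) ≫ tripleWhisker p.L.inv (C ⊗ B ⊗ B ⊗ 𝟙_ E) :=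
    tripleWhisker_comp_whiskerLeft _ _
  have hN₂ : (C ◁ tripleWhisker p.L.inv (B ⊗ B)) ≫ j =
      j ≫ C ◁ tripleWhisker p.L.inv (B ⊗ B ⊗ 𝟙_ E) :=
    whiskerLeft_comm _ (tripleWhisker_comp_whiskerLeft _ _)
  have e₁₂₄ : (p.L₁₂₄ u).inv = C ◁ C ◁ doubleWhisker tCB (B ⊗ B) ≫
      tripleWhisker p.L.inv (C ⊗ B ⊗ B) ≫ C ◁ C ◁ doubleWhisker tBC (B ⊗ B) := by
    simp only [Pair.L₁₂₄, conjBy, Iso.trans_inv, Iso.symm_inv, whiskerLeftIso_inv,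
      whiskerLeftIso_hom, onThree_inv, onTwo_inv, onTwo_hom, Category.assoc, hCB']
  have e₁₃₅ : (p.L₁₃₅ u).inv = C ◁ doubleWhisker tCC (B ⊗ B ⊗ B) ≫
      C ◁ C ◁ C ◁ doubleWhisker tBB B ≫ C ◁ C ◁ doubleWhisker tCB (B ⊗ B) ≫
      tripleWhisker p.L.inv (C ⊗ B ⊗ B) ≫ C ◁ C ◁ doubleWhisker tBC (B ⊗ B) ≫
      C ◁ C ◁ C ◁ doubleWhisker tBB B ≫ C ◁ doubleWhisker tCC (B ⊗ B ⊗ B) := by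
    simp only [Pair.L₁₃₅, conjBy, Iso.trans_inv, Iso.trans_hom, Iso.symm_inv, whiskerLeftIso_inv,
      whiskerLeftIso_hom, onThree_inv, onTwo_inv, onTwo_hom, Category.assoc, hCB', hBB', hCC']
  have e₂₃₆ : (p.L₂₃₆ u).inv = C ◁ C ◁ C ◁ B ◁ tBB ≫ C ◁ C ◁ C ◁ doubleWhisker tBB B ≫
      C ◁ tripleWhisker p.L.inv (B ⊗ B) ≫ C ◁ C ◁ C ◁ doubleWhisker tBB B ≫
      C ◁ C ◁ C ◁ B ◁ tBB := by
    simp only [Pair.L₂₃₆, conjBy, Iso.trans_inv, Iso.trans_hom, Iso.symm_inv, whiskerLeftIso_inv,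
      whiskerLeftIso_hom, onThree_inv, onTwo_inv, onTwo_hom, Category.assoc, hBB']
  have c₁₂₄ := comp_conj (j := j) (j'' := j) (ht₁ tCB) (comp_conj hN (ht₁ tBC))
  have c₁₃₅ := comp_conj ht₂ (comp_conj ht₄ (comp_conj (ht₁ tCB) (comp_conj hN
    (comp_conj (j'' := j) (ht₁ tBC) (comp_conj ht₄ ht₂)))))
  have c₂₃₆ := comp_conj ht₅ (comp_conj ht₄ (comp_conj hN₂ (comp_conj ht₄ ht₅)))
  rw [← e₁₂₄] at c₁₂₄
  rw [← e₁₃₅] at c₁₃₅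
  rw [← e₂₃₆] at c₂₃₆
  rw [Pair.Relation, opposite_products_iff,
    ← Iso.cancel_iso_hom_right _ _ (appendUnit C C C B B B)]
  change _ ≫ j = _ ≫ j ↔ _
  rw [comp_conj hz (comp_conj c₁₂₄ (comp_conj c₁₃₅ c₂₃₆)),
    comp_conj c₂₃₆ (comp_conj c₁₃₅ (comp_conj c₁₂₄ hz))]
  exact Iso.cancel_iso_hom_left (appendUnit C C C B B B) _ _

/-- Here `six_strand_equation` is applied with `N = L⁻¹` and `W = 𝟙_ E`. The half-braidings
`halfBraidingB` and `halfBraidingC` have `tB` and `tC` as components by definition. -/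
theorem toData_coherent_iff (hBB : tB S u B ≪≫ tB S u B = Iso.refl _)
    (hp : SymmetricHalfBraidings u p.C) : (p.toData u).Coherent ↔ p.Relation u := by
  have hM : (cellM u (p.toData u)).hom = (reversalBCC u p.C).hom ≫ p.L.inv :=
    congrArg Iso.hom ((cellEquiv u p.C).apply_symm_apply (reversalBCC u p.C ≪≫ p.L.symm))
  have hS : (autS S u).hom = (autZ S u).hom ≫
      (reversal (tB S u B) (tB S u B) (tB S u B)).hom := by
    simp [autZ]
  -- The inverse cells of `C` in the pastings become `t_{B,C}`, the crossing that occurs in the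
  -- strand calculus.
  have hCB : (tC u (p.toData u).cmp B).inv = tBC := inv_eq_hom_of_trans_eq_refl hp.2.1
  have h := coherent_iff u (p.toData u)
  rw [hCB] at h
  exact (h.trans (six_strand_equation (halfBraidingB S u) (halfBraidingC u p.C)
    (congrArg Iso.hom hBB) (congrArg Iso.hom hp.1) (congrArg Iso.hom hp.2.1)
    (congrArg Iso.hom hp.2.2) p.L.inv (autZ S u).hom (𝟙_ E) _ hM _ hS _ _ _ rfl rfl rfl)).trans
    (relation_iff u p hBB hp).symm

end Relation

theorem toPair_toData : toPair u (p.toData u) = p := by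
  have h : (cellM u (p.toData u)) = reversalBCC u p.C ≪≫ p.L.symm :=
    (cellEquiv u p.C).apply_symm_apply _
  have h' : (reversalBCC u p.C ≪≫ p.L.symm).symm ≪≫ reversalBCC u p.C = p.L := by
    ext; simp
  obtain ⟨c, l⟩ := p
  exact congrArg (Pair.mk c) ((congrArg (fun m => Iso.symm m ≪≫ reversalBCC u c) h).trans h')

theorem toData_toPair (Φ : WeakBFunctorData S S (Pseudofunctor.id (MonoidalSingleObj E))) :
    (toPair u Φ).toData u = Φ := by
  have h : reversalBCC u Φ.cmp ≪≫ ((cellM u Φ).symm ≪≫ reversalBCC u Φ.cmp).symm = cellM u Φ := by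
    ext; simp
  obtain ⟨c, φ⟩ := Φ
  -- The reconstructed family is constant; this loses nothing because there is only one object.
  exact congrArg (WeakBFunctorData.mk c) (funext fun _ => funext fun _ => funext fun _ =>
    (congrArg (cellEquiv u c).symm h).trans ((cellEquiv u c).symm_apply_apply _))

theorem coherent_iff_relation (Φ : WeakBFunctorData S S (Pseudofunctor.id (MonoidalSingleObj E)))
    (hBB : tB S u (objB S) ≪≫ tB S u (objB S) = Iso.refl _)
    (hΦ : SymmetricHalfBraidings u Φ.cmp) : Φ.Coherent ↔ (toPair u Φ).Relation u := by
  rw [← toData_coherent_iff u (toPair u Φ) hBB hΦ, toData_toPair]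

theorem natural_iff (Φ : WeakBFunctorData S S (Pseudofunctor.id (MonoidalSingleObj E))) :
    Φ.Natural ↔ (toPair u Φ).Natural u := by
  rw [Pair.Natural, toData_toPair]

end OneObject

end BBicat

/-! ### The two bijections -/

theorem proposition4p2 {E : Type*} [Category E] [MonoidalCategory E]
    (S : BBicat.WeakBBicategory (MonoidalSingleObj E))
    (i : BBicat.UnitIdentification S.tensor)
    (hB : BBicat.tB S.toWeakBData i (BBicat.objB S.toWeakBData) ≪≫
      BBicat.tB S.toWeakBData i (BBicat.objB S.toWeakBData) = Iso.refl _) :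
    Set.BijOn
        (fun Φ : BBicat.WeakBFunctor S S (Pseudofunctor.id (MonoidalSingleObj E)) =>
          BBicat.toPair i Φ.toWeakBFunctorData)
        {Φ | BBicat.SymmetricHalfBraidings i Φ.cmp}
        {p | BBicat.SymmetricHalfBraidings i p.C ∧ p.Natural i ∧ p.Relation i} ∧
      Set.BijOn (BBicat.toPair (S := S.toWeakBData) i)
        {Φ | BBicat.SymmetricHalfBraidings i Φ.cmp ∧ Φ.Coherent}
        {p | BBicat.SymmetricHalfBraidings i p.C ∧ p.Relation i} := by
  have hinj : Function.Injective (BBicat.toPair (S := S.toWeakBData) i) :=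
    Function.LeftInverse.injective (BBicat.toData_toPair i)
  refine ⟨⟨fun Φ hΦ => ⟨hΦ, (BBicat.natural_iff i _).1 Φ.natural,
    (BBicat.coherent_iff_relation i _ hB hΦ).1 Φ.coherent⟩, fun Φ _ Ψ _ h => ?_,
    fun p ⟨hp, hn, hr⟩ => ⟨⟨p.toData i, hn, (BBicat.toData_coherent_iff i p hB hp).2 hr⟩, hp,
      BBicat.toPair_toData i p⟩⟩,
    ⟨fun Φ hΦ => ⟨hΦ.1, (BBicat.coherent_iff_relation i Φ hB hΦ.1).1 hΦ.2⟩, hinj.injOn,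
      fun p ⟨hp, hr⟩ => ⟨p.toData i, ⟨hp, (BBicat.toData_coherent_iff i p hB hp).2 hr⟩,
        BBicat.toPair_toData i p⟩⟩⟩
  -- The remaining fields are propositions, so injectivity on the underlying data suffices.
  obtain ⟨Φ, _, _⟩ := Φ
  obtain ⟨Ψ, _, _⟩ := Ψ
  obtain rfl : Φ = Ψ := hinj h
  rfl
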